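/- Let $q$ be a power of an odd prime $p$, let $m=2\ell>3$ be an even integer, let $e\ge 1$ be an integer such that $m/\gcd(m,e)$ is even, and put $\epsilon=0$ if $\ell/\gcd(m,e)$ is odd and $\epsilon=\gcd(m,e)$ if $\ell/\gcd(m,e)$ is even. Let $\mathrm{Tr}$ be the trace from $\mathbb F_{q^m}$ to $\mathbb F_q$, let $\eta_1$ be the quadratic character of $\mathbb F_q$, and let $m_p\in\mathbb F_p\subseteq\mathbb F_q$ be the residue of $m$ modulo $p$. Assume that $m>2\epsilon+2$ if $m_p\neq 0$. For $u\in\mathbb F_q$ let $$D_1=\{x\in\mathbb F_{q^m}^*:\ \mathrm{Tr}(x^{q^e+1})=u,\ \mathrm{Tr}(x)=0\},\qquad \mathcal C_{D_1}=\{(\mathrm{Tr}(bx))_{x\in D_1}:\ b\in\mathbb F_{q^m}\}\subseteq\mathbb F_q^{D_1}.$$ Then the linear code $\mathcal C_{D_1}$ has dimension $m-1$ over $\mathbb F_q$ and is a $3$-weight code, i.e. exactly three nonzero Hamming weights occur among its codewords. Its length $n=|D_1|$, its minimum distance $d$ and its weight distribution are as follows. Here $A_w$ is the number of codewords of Hamming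 weight $w$; in each case $A_0=1$, and $A_w=0$ for every $w$ that is neither $0$ nor listed. 1) If $u=0$ and $m_p\ne0$: $n=q^{m-2}-1$, $d=(q-1)(q^{m-3}-q^{\ell+\epsilon-2})$, and - $A_w=q^{m-1}-(q-1)q^{m-2\epsilon-2}-1$ for $w=(q-1)q^{m-3}$; - $A_w=\frac12(q-1)(q^{m-2\epsilon-2}-q^{\ell-\epsilon-1})$ for $w=(q-1)(q^{m-3}+q^{\ell+\epsilon-2})$; - $A_w=\frac12(q-1)(q^{m-2\epsilon-2}+q^{\ell-\epsilon-1})$ for $w=(q-1)(q^{m-3}-q^{\ell+\epsilon-2})$. 2) If $u=0$ and $m_p=0$: $n=q^{m-2}-(q-1)q^{\ell+\epsilon-1}-1$, $d=(q-1)(q^{m-3}-q^{\ell+\epsilon-1})$, and - $A_w=q^{m-2\epsilon-3}-(q-1)q^{\ell-\epsilon-2}-1$ for $w=(q-1)q^{m-3}$; - $A_w=(q-1)(q^{m-2\epsilon-3}+q^{\ell-\epsilon-2})$ for $w=(q-1)(q^{m-3}-q^{\ell+\epsilon-1})$; - $A_w=q^{m-1}-q^{m-2\epsilon-2}$ for $w=(q-1)(q^{m-3}+q^{\ell+\epsilon-2}-q^{\ell+\epsilon-1})$.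 3) If $u\ne0$ and $m_p\ne0$, put $\eta=\eta_1(-um_p)\in\{1,-1\}$: $n=q^{m-2}-q^{\ell+\epsilon-1}\eta$, and - $A_w=q^{m-2\epsilon-2}-1$ for $w=(q-1)q^{m-3}$; - $A_w=\frac12(q^{m-1}-q^{m-2\epsilon-2}-q^{m-2\epsilon-1}\eta+q^{m-1}\eta+q^{\ell-\epsilon}-q^{\ell-\epsilon-1})$ for $w=(q-1)q^{m-3}-q^{\ell+\epsilon-1}\eta+q^{\ell+\epsilon-2}$; - $A_w=\frac12(q^{m-1}-q^{m-2\epsilon-2}+q^{m-2\epsilon-1}\eta-q^{m-1}\eta-q^{\ell-\epsilon}+q^{\ell-\epsilon-1})$ for $w=(q-1)q^{m-3}-q^{\ell+\epsilon-1}\eta-q^{\ell+\epsilon-2}$. (In this case $d$ is the smallest of the listed weights and is not given by a separate formula.) 4) If $u\ne0$ and $m_p=0$: $n=q^{m-2}+q^{\ell+\epsilon-1}$, $d=(q-1)q^{m-3}$, and - $A_w=q^{m-2\epsilon-2}-\frac12(q-1)(q^{m-2\epsilon-3}+q^{\ell-\epsilon-2})-1$ for $w=(q-1)q^{m-3}$;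 - $A_w=\frac12(q-1)(q^{m-2\epsilon-3}+q^{\ell-\epsilon-2})$ for $w=(q-1)q^{m-3}+2q^{\ell+\epsilon-1}$; - $A_w=q^{m-1}-q^{m-2\epsilon-2}$ for $w=(q-1)(q^{m-3}+q^{\ell+\epsilon-2})$. -/

import Mathlib

section TraceCodes

/-- The `F`-linear map `b ↦ (Tr (b * x))_{x ∈ D}`, where `Tr` is the trace from `K` to `F`. -/
noncomputable def traceWord (F : Type*) {K : Type*} [Field F] [Field K] [Algebra F K]
    (D : Finset K) : K →ₗ[F] (D → F) :=
  LinearMap.pi fun x => (Algebra.trace F K).comp (LinearMap.mulRight F (x : K))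

/-- The trace code `C_D = {(Tr (b * x))_{x ∈ D} : b ∈ K}` with defining set `D`; its coordinates
are indexed by the elements of `D`. -/
noncomputable def traceCode (F : Type*) {K : Type*} [Field F] [Field K] [Algebra F K]
    (D : Finset K) : Submodule F (D → F) :=
  LinearMap.range (traceWord F D)

/-- `D₁ = {x ∈ K, x ≠ 0 : Tr (x ^ (q ^ e + 1)) = u, Tr x = v}`, where `q = |F|`. -/
noncomputable def definingSetOne (F K : Type*) [Field F] [Field K] [Fintype F] [Fintype K]
    [DecidableEq F] [DecidableEq K] [Algebra F K] (e : ℕ) (u v : F) : Finset K :=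
  Finset.univ.filter fun x =>
    x ≠ 0 ∧ Algebra.trace F K (x ^ (Fintype.card F ^ e + 1)) = u ∧ Algebra.trace F K x = v

/-- `ε = 0` if `ℓ / gcd (m, e)` is odd, and `ε = gcd (m, e)` if it is even, where `m = 2 * ℓ`.
(Used only when `m / gcd (m, e)` is even, so that `gcd (m, e)` divides `ℓ`.) -/
def epsilonOf (ℓ e : ℕ) : ℕ :=
  if Odd (ℓ / Nat.gcd (2 * ℓ) e) then 0 else Nat.gcd (2 * ℓ) e

/-- The number `A_w` of codewords of Hamming weight `w`. -/
noncomputable def weightCount {F ι : Type*} [Field F] [DecidableEq F] [Fintype ι]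
    (C : Submodule F (ι → F)) (w : ℕ) : ℕ :=
  Set.ncard {c : ι → F | c ∈ C ∧ hammingNorm c = w}

/-- `C` has minimum distance `d`: it is the least Hamming distance of two distinct codewords. -/
def HasMinDistance {F ι : Type*} [Field F] [DecidableEq F] [Fintype ι]
    (C : Submodule F (ι → F)) (d : ℕ) : Prop :=
  IsLeast {r : ℕ | ∃ c ∈ C, ∃ c' ∈ C, c ≠ c' ∧ hammingDist c c' = r} d

/-- `C` is a `t`-weight code: exactly `t` nonzero weights occur among its codewords. -/
def IsWeightCode {F ι : Type*} [Field F] [DecidableEq F] [Fintype ι]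
    (t : ℕ) (C : Submodule F (ι → F)) : Prop :=
  Set.encard {w : ℕ | w ≠ 0 ∧ weightCount C w ≠ 0} = t

/-- `C` has the weight distribution given by a table of pairs (weight, frequency): every listed
weight is a natural number that occurs with the listed frequency, and no other weight occurs. -/
def HasWeightDistribution {F ι : Type*} [Field F] [DecidableEq F] [Fintype ι]
    (C : Submodule F (ι → F)) (T : List (ℚ × ℚ)) : Prop :=
  (∀ r ∈ T, ∃ w : ℕ, (w : ℚ) = r.1 ∧ (weightCount C w : ℚ) = r.2) ∧
    ∀ w : ℕ, (∀ r ∈ T, (w : ℚ) ≠ r.1) → weightCount C w = 0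

end TraceCodes

/-! Put Q(x) = Tr(x^(q^e+1)), a quadratic form on K over F. Its polar form pairs x with 1 to 2 Tr x,
and Q(1) = m. So D₁ is, up to the point 0, the quadric Q = u cut by the hyperplane orthogonal to 1,
and the weights come from counting points of Q = u on orthogonal complements.

Every c in F^* is a (q^e+1)-th power in K, so scaling shows that Q takes all nonzero values equally
often (`card_powForm_eq`). Hence the sums Σ ψ(aQ(x)), a ≠ 0, all equal one integer S = `zeroExcess
Q`, and completing the square in a character sum gives the duality `card_orthogonal_eq` between
points on the complement of the image of φ and points of Q ∘ φ. With φ the identity it yields S² =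
|K| |rad Q|. The radical is y^(q^(2e)) = -y, of order q^(2ε), and divisibility by q^g + 1, g =
gcd(m, e), forces S = -q^(ℓ+ε) (`zeroExcess_powForm`).

Let A be the endomorphism with Tr(A(y) x) = polar(x, y). If b is not in the image of A, then Tr(bx)
varies along the radical, so it is equidistributed on the section and all such words share one
weight (`weight_off_range`). If b = A(y) is not in F, the zeros of the word form the complement of
the plane spanned by 1 and y, and the weight depends only on the number of solutions of Q(t + zy) =
m t² + 2tz Tr y + z² Q(y) = -u (`weight_apply`). For m ≠ 0 in F this number is decided by the
quadratic character of Tr(y)² - m Q(y), for m = 0 by Tr y and Q(y); either way three classes of y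
remain, and the same duality counts them. The b in F give the zero word, and the class sizes show
that no other b does, so the dimension is m - 1. -/

/-! ### Character sums and counting duality for quadratic forms -/

section QuadraticFormCounting

open Finset

variable {F V : Type*} [Field F] [AddCommGroup V] [Module F V] [Fintype V]

/-- The sum of a nontrivial additive character over a linear functional is `|V|` or `0`. -/
theorem sum_addChar_linearMap {ψ : AddChar F ℂ} (hψ : ψ.IsPrimitive) (f : V →ₗ[F] F)
    [Decidable (∀ x, f x = 0)] :
    ∑ x, ψ (f x) = if ∀ x, f x = 0 then (Fintype.card V : ℂ) else 0 := by
  classical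
  split_ifs with h
  · simp [h]
  · push Not at h
    obtain ⟨x₀, hx₀⟩ := h
    have hψ1 : ψ.mulShift (f x₀) ≠ 1 := hψ hx₀
    obtain ⟨a, ha⟩ := AddChar.ne_one_iff.mp hψ1
    rw [AddChar.mulShift_apply] at ha
    have h1 : ∑ x, ψ (f x) = ψ (f x₀ * a) * ∑ x, ψ (f x) := by
      rw [mul_sum, ← Equiv.sum_comp (Equiv.addLeft (a • x₀))]
      refine sum_congr rfl fun x _ => ?_
      simp [AddChar.map_add_eq_mul, mul_comm]
    have h2 : (1 - ψ (f x₀ * a)) * ∑ x, ψ (f x) = 0 := by linear_combination h1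
    rcases mul_eq_zero.mp h2 with h3 | h3
    · exact absurd (sub_eq_zero.mp h3).symm ha
    · exact h3

variable [Fintype F] [DecidableEq F]

theorem sum_addChar_mul {ψ : AddChar F ℂ} (hψ : ψ.IsPrimitive) (b : F) :
    ∑ a, ψ (a * b) = if b = 0 then (Fintype.card F : ℂ) else 0 := by
  rw [AddChar.sum_mulShift b hψ]
  split_ifs <;> simp

/-- The number of zeros of `Q` minus the number of solutions of `Q x = 1`. -/
def zeroExcess (Q : QuadraticForm F V) : ℤ :=
  (#{x | Q x = 0} : ℤ) - #{x | Q x = 1}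

variable {Q : QuadraticForm F V}

/-- If all nonzero values are taken equally often, the exponential sums of `Q` are integers. -/
theorem sum_addChar_quadraticForm {ψ : AddChar F ℂ} (hψ : ψ.IsPrimitive)
    (hQ : ∀ c, c ≠ 0 → #{x | Q x = c} = #{x | Q x = 1}) {a : F} (ha : a ≠ 0) :
    ∑ x, ψ (a * Q x) = zeroExcess Q := by
  have h1 : ∑ x, ψ (a * Q x) = ∑ c, (#{x | Q x = c} : ℂ) * ψ (a * c) := by
    rw [← sum_fiberwise univ (fun x => Q x)]
    refine sum_congr rfl fun c _ => ?_
    rw [sum_congr rfl (g := fun _ => ψ (a * c))]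
    · simp
    · intro x hx
      rw [(mem_filter.mp hx).2]
  -- The nonzero c therefore contribute -1 in total, which turns the weighted sum over values into
  -- the difference of two counts.
  have h2 : ∑ c, ψ (a * c) = 0 := by
    simp_rw [mul_comm a]
    rw [sum_addChar_mul hψ, if_neg ha]
  rw [h1, ← add_sum_erase _ _ (mem_univ 0)]
  rw [← add_sum_erase _ _ (mem_univ 0)] at h2
  have h3 : ∑ c ∈ univ.erase 0, (#{x | Q x = c} : ℂ) * ψ (a * c)
      = (#{x | Q x = 1} : ℂ) * ∑ c ∈ univ.erase 0, ψ (a * c) := by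
    rw [mul_sum]
    refine sum_congr rfl fun c hc => ?_
    rw [hQ c (ne_of_mem_erase hc)]
  rw [h3]
  simp only [mul_zero, AddChar.map_zero_eq_one] at h2 ⊢
  simp only [zeroExcess]
  push_cast
  linear_combination (#{x | Q x = 1} : ℂ) * h2

open QuadraticMap in
/-- Counting duality: the solutions of `Q x = u` in the orthogonal complement of the image of `φ`
are counted by the solutions of `Q (φ c) = -u`. -/
theorem card_orthogonal_eq {U : Type*} [AddCommGroup U] [Module F U] [Fintype U]
    (hQ : ∀ c, c ≠ 0 → #{x | Q x = c} = #{x | Q x = 1}) (φ : U →ₗ[F] V) (u : F)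
    [DecidablePred fun x => ∀ c, polar Q x (φ c) = 0]
    [DecidablePred fun c => ∀ x, polar Q x (φ c) = 0] :
    (Fintype.card F : ℤ) * Fintype.card U * #{x | (∀ c, polar Q x (φ c) = 0) ∧ Q x = u}
      = Fintype.card V * #{c | ∀ x, polar Q x (φ c) = 0}
        + zeroExcess Q * (Fintype.card F * #{c | Q (φ c) = -u} - Fintype.card U) := by
  classical
  set ψ := AddChar.FiniteField.primitiveChar_to_Complex F
  have hψ : ψ.IsPrimitive := AddChar.FiniteField.primitiveChar_to_Complex_isPrimitive F
  -- The sum over s detects Q x = u and the sum over c detects orthogonality to the image of φ.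
  -- Summing over x first gives the other side: s = 0 sees the radical, s ≠ 0 is a Gauss-type sum.
  let Z : ℂ := ∑ s : F, ∑ c : U, ∑ x : V, ψ (s * (Q x - u) + polar Q x (φ c))
  have h1 : Z = (Fintype.card F : ℂ) * Fintype.card U
      * #{x | (∀ c, polar Q x (φ c) = 0) ∧ Q x = u} := by
    have h : ∀ x : V, ∑ s : F, ∑ c : U, ψ (s * (Q x - u) + polar Q x (φ c))
        = if (∀ c, polar Q x (φ c) = 0) ∧ Q x = u
          then (Fintype.card F : ℂ) * Fintype.card U else 0 := by
      intro x
      simp_rw [AddChar.map_add_eq_mul]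
      rw [← sum_mul_sum, sum_addChar_mul hψ]
      have := sum_addChar_linearMap hψ ((Q.polarBilin x).comp φ)
      simp only [LinearMap.comp_apply, polarBilin_apply_apply] at this
      rw [this]
      simp only [sub_eq_zero]
      split_ifs <;> simp_all
    calc Z = ∑ x : V, ∑ s : F, ∑ c : U, ψ (s * (Q x - u) + polar Q x (φ c)) := by
          rw [sum_comm]
          refine sum_congr rfl fun s _ => ?_
          rw [sum_comm]
      _ = _ := by
          simp_rw [h]
          rw [← sum_filter, sum_const, nsmul_eq_mul, mul_comm]
  have h2 : ∑ c : U, ∑ x : V, ψ (0 * (Q x - u) + polar Q x (φ c))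
      = (Fintype.card V : ℂ) * #{c | ∀ x, polar Q x (φ c) = 0} := by
    have h : ∀ c : U, ∑ x : V, ψ (0 * (Q x - u) + polar Q x (φ c))
        = if ∀ x, polar Q x (φ c) = 0 then (Fintype.card V : ℂ) else 0 := by
      intro c
      have := sum_addChar_linearMap hψ (Q.polarBilin.flip (φ c))
      simp only [LinearMap.flip_apply, polarBilin_apply_apply] at this
      simp only [zero_mul, zero_add, this]
    simp_rw [h]
    rw [← sum_filter, sum_const, nsmul_eq_mul, mul_comm]
  have h3 : ∀ s : F, s ≠ 0 → ∑ c : U, ∑ x : V, ψ (s * (Q x - u) + polar Q x (φ c))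
      = zeroExcess Q * ∑ c : U, ψ (s * (- Q (φ c) - u)) := by
    intro s hs
    -- Replacing c by s c puts the factor s on the polar term as well, so that Q x + polar(x, φ c) =
    -- Q(x + φ c) - Q(φ c) completes the square.
    rw [mul_sum, ← Equiv.sum_comp (DistribMulAction.toAddEquiv₀ U s hs).toEquiv]
    refine sum_congr rfl fun c _ => ?_
    rw [← sum_addChar_quadraticForm hψ hQ hs, sum_mul,
      ← Equiv.sum_comp (Equiv.addRight (φ c)) (fun x => ψ (s * Q x) * _)]
    refine sum_congr rfl fun x _ => ?_
    rw [← AddChar.map_add_eq_mul]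
    congr 1
    have e1 : Q (x + φ c) = Q x + Q (φ c) + polar Q x (φ c) := by
      simp [polar]
    have e2 : polar Q x (φ (s • c)) = s * polar Q x (φ c) := by
      rw [map_smul, polar_smul_right, smul_eq_mul]
    change s * (Q x - u) + polar Q x (φ (s • c)) = s * Q (x + φ c) + s * (- Q (φ c) - u)
    rw [e1, e2]
    ring
  have h4 : ∑ s : F, ∑ c : U, ψ (s * (- Q (φ c) - u))
      = (Fintype.card F : ℂ) * #{c | Q (φ c) = -u} := by
    rw [sum_comm]
    simp_rw [sum_addChar_mul hψ]
    rw [← sum_filter, sum_const, nsmul_eq_mul, mul_comm]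
    congr 3
    ext c
    simp only [mem_filter, mem_univ, true_and]
    constructor <;> intro h <;> linear_combination -h
  have h5 : Z = (Fintype.card V : ℂ) * #{c | ∀ x, polar Q x (φ c) = 0}
        + zeroExcess Q * (Fintype.card F * #{c | Q (φ c) = -u} - Fintype.card U) := by
    simp only [Z]
    rw [← h4, ← add_sum_erase _ _ (mem_univ 0), h2, ← add_sum_erase univ
      (fun s => ∑ c : U, ψ (s * (- Q (φ c) - u))) (mem_univ 0),
      sum_congr rfl fun s hs => h3 s (ne_of_mem_erase hs), ← mul_sum]
    simp
  have := h1.symm.trans h5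
  exact_mod_cast this

/-- The number of solutions of `Q x = 1` in terms of `zeroExcess Q`. -/
theorem card_mul_card_eq_one (hQ : ∀ c, c ≠ 0 → #{x | Q x = c} = #{x | Q x = 1}) :
    (Fintype.card F : ℤ) * #{x | Q x = 1} = Fintype.card V - zeroExcess Q := by
  have : Fintype.card V = ∑ c, #{x | Q x = c} := by
    rw [← card_univ]
    exact card_eq_sum_card_fiberwise (fun _ _ => mem_univ _)
  rw [this, ← add_sum_erase _ _ (mem_univ 0),
    sum_congr rfl fun c hc => hQ c (ne_of_mem_erase hc), sum_const, card_erase_of_mem (mem_univ _),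
    card_univ, smul_eq_mul, zeroExcess]
  push_cast [Fintype.card_pos (α := F)]
  ring

/-- The square of `zeroExcess Q` is `|V|` times the order of the radical. -/
theorem zeroExcess_sq (h2 : (2 : F) ≠ 0)
    (hQ : ∀ c, c ≠ 0 → #{x | Q x = c} = #{x | Q x = 1})
    [DecidablePred fun y => ∀ x, QuadraticMap.polar Q x y = 0] :
    zeroExcess Q ^ 2 = Fintype.card V * #{y | ∀ x, QuadraticMap.polar Q x y = 0} := by
  classical
  -- For φ the identity the complement is the radical, where Q vanishes because 2 Q(y) = polar(y,
  -- y). The duality becomes an equation for S²(q - 1).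
  have hd := card_orthogonal_eq hQ (LinearMap.id : V →ₗ[F] V) 0
  simp only [LinearMap.id_apply, neg_zero] at hd
  have h0 : ({x | (∀ c, QuadraticMap.polar Q x c = 0) ∧ Q x = 0} : Finset V)
      = ({y | ∀ x, QuadraticMap.polar Q x y = 0} : Finset V) := by
    ext y
    simp only [mem_filter, mem_univ, true_and]
    constructor
    · intro h x
      rw [QuadraticMap.polar_comm]
      exact h.1 x
    · intro h
      refine ⟨fun x => by rw [QuadraticMap.polar_comm]; exact h x, ?_⟩
      have := h y
      rw [QuadraticMap.polar_self, two_nsmul, ← two_mul] at this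
      exact (mul_eq_zero.mp this).resolve_left h2
  rw [h0] at hd
  have hV := card_mul_card_eq_one hQ
  have hq : (Fintype.card F : ℤ) - 1 ≠ 0 := by
    have := Fintype.one_lt_card (α := F)
    omega
  have hs : (Fintype.card F : ℤ) * #{x | Q x = 0} - Fintype.card V
      = (Fintype.card F - 1) * zeroExcess Q := by
    rw [zeroExcess] at hV ⊢
    linear_combination hV
  rw [hs] at hd
  apply mul_left_cancel₀ hq
  linear_combination -hd

end QuadraticFormCounting

/-! ### Equations x^(q^j) = ±x and power residues in finite fields -/

section FrobeniusFixedPoints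

open Finset

variable {K : Type*} [Field K]

theorem pow_pow_mul_eq_self {x : K} {n : ℕ} (h : x ^ n = x) (j : ℕ) : x ^ n ^ j = x := by
  induction j with
  | zero => simp
  | succ j ih => rw [pow_succ, pow_mul, ih, h]

theorem pow_pow_odd_eq_neg {x : K} {n : ℕ} (hn : Odd n) (h : x ^ n = -x) {j : ℕ} (hj : Odd j) :
    x ^ n ^ j = -x := by
  obtain ⟨i, rfl⟩ := hj
  have h2 : x ^ (n ^ 2) = x := by rw [sq, pow_mul, h, hn.neg_pow, h, neg_neg]
  rw [pow_succ, pow_mul, pow_mul, pow_pow_mul_eq_self h2, h]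

variable [Fintype K] [DecidableEq K]

theorem card_filter_pow_eq_one (n : ℕ) (hn : 0 < n) :
    #{x : K | x ^ n = 1} = Nat.gcd (Fintype.card K - 1) n := by
  classical
  have h := IsCyclic.card_powMonoidHom_ker (G := Kˣ) n
  rw [Nat.card_eq_fintype_card, Nat.card_eq_fintype_card, Fintype.card_units] at h
  rw [← h]
  symm
  rw [← Fintype.card_subtype]
  refine Fintype.card_congr ⟨fun x => ⟨(x : Kˣ), ?_⟩, fun x => ⟨Units.mk0 x.1 ?_, ?_⟩, ?_, ?_⟩
  · have := x.2
    rw [MonoidHom.mem_ker, powMonoidHom_apply] at this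
    rw [← Units.val_pow_eq_pow_val, this, Units.val_one]
  · intro h0
    have := x.2
    rw [h0, zero_pow hn.ne'] at this
    exact zero_ne_one this
  · rw [MonoidHom.mem_ker, powMonoidHom_apply]
    ext
    simpa using x.2
  · intro x
    ext
    simp
  · intro x
    ext
    simp

/-- The fixed points of a power of the Frobenius map. -/
theorem card_filter_pow_card_eq_self {q m : ℕ} (hq : 1 < q) (hK : Fintype.card K = q ^ m) (j : ℕ)
    (hj : 0 < j) : #{x : K | x ^ q ^ j = x} = q ^ Nat.gcd m j := by
  have hqj : 1 < q ^ j := Nat.one_lt_pow hj.ne' hq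
  have h1 : univ.filter (fun x : K => x ^ q ^ j = x)
      = insert 0 (univ.filter fun x : K => x ^ (q ^ j - 1) = 1) := by
    ext x
    simp only [mem_filter, mem_univ, true_and, mem_insert]
    by_cases hx : x = 0
    · simp [hx, zero_pow (by omega : q ^ j ≠ 0)]
    · simp only [hx, false_or]
      rw [← mul_left_inj' hx (a := x ^ (q ^ j - 1)), ← pow_succ, one_mul,
        Nat.sub_add_cancel hqj.le]
  have h0 : (0 : K) ∉ univ.filter (fun x : K => x ^ (q ^ j - 1) = 1) := by
    simp [zero_pow (by omega : q ^ j - 1 ≠ 0)]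
  rw [h1, card_insert_of_notMem h0, card_filter_pow_eq_one _ (by omega), hK,
    Nat.pow_sub_one_gcd_pow_sub_one, Nat.sub_add_cancel (Nat.one_le_pow _ _ (by omega))]

/-- An element of order dividing `N / n` in the cyclic group of order `N` is an `n`-th power. -/
theorem exists_pow_eq_of_pow_eq_one {n k : ℕ} (hnk : Fintype.card K - 1 = n * k) {a : K}
    (ha0 : a ≠ 0) (ha : a ^ k = 1) : ∃ x : K, x ^ n = a := by
  obtain ⟨g, hg⟩ := IsCyclic.exists_generator (α := Kˣ)
  obtain ⟨i, hi⟩ := mem_powers_iff_mem_zpowers.mpr (hg (Units.mk0 a ha0))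
  have hN : orderOf g = n * k := by
    rw [orderOf_eq_card_of_forall_mem_zpowers hg, Nat.card_eq_fintype_card, Fintype.card_units, hnk]
  have hi' : g ^ i = Units.mk0 a ha0 := hi
  have h1 : g ^ (i * k) = 1 := by
    rw [pow_mul, hi']
    ext
    simpa using ha
  have h2 : n * k ∣ i * k := hN ▸ orderOf_dvd_of_pow_eq_one h1
  have hk : 0 < k := by
    have := Fintype.one_lt_card (α := K)
    rcases Nat.eq_zero_or_pos k with h | h
    · simp [h] at hnk
      omega
    · exact h
  obtain ⟨j, hj⟩ := Nat.dvd_of_mul_dvd_mul_right hk h2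
  refine ⟨(g ^ j : Kˣ), ?_⟩
  rw [← Units.val_pow_eq_pow_val, ← pow_mul, mul_comm, ← hj, hi', Units.val_mk0]

/-- The solutions of `x ^ q ^ (2 g f) = -x` in the field with `q ^ (2 g s)` elements. -/
theorem card_filter_pow_card_eq_neg {p k q g s f : ℕ} [Fact p.Prime] [CharP K p]
    (hqp : q = p ^ k) (hq : 1 < q) (hqo : Odd q) (h2 : (2 : K) ≠ 0)
    (hK : Fintype.card K = q ^ (2 * g * s)) (hg : 0 < g) (hs : 0 < s) (hf : Odd f)
    (hsf : Nat.Coprime s f) :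
    #{x : K | x ^ q ^ (2 * (g * f)) = -x} = if Odd s then 1 else q ^ (2 * g) := by
  have hf0 : 0 < f := hf.pos
  have hneg : ∀ x : K, x = -x → x = 0 := fun x hx => by
    have : (2 : K) * x = 0 := by linear_combination hx
    exact (mul_eq_zero.mp this).resolve_left h2
  split_ifs with hso
  · rw [card_eq_one]
    refine ⟨0, ?_⟩
    ext x
    simp only [mem_filter, mem_univ, true_and, mem_singleton]
    constructor
    · intro hx
      -- Iterating the map s times, s odd, still gives -x, but it is also a power of the
      -- |K|-Frobenius, which fixes x.
      have h3 := pow_pow_odd_eq_neg (hqo.pow) hx hso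
      rw [← pow_mul, (by ring : 2 * (g * f) * s = 2 * g * s * f), pow_mul, ← hK,
        pow_pow_mul_eq_self (FiniteField.pow_card x)] at h3
      exact hneg x h3
    · rintro rfl
      rw [zero_pow (pow_ne_zero _ (by omega)), neg_zero]
  · obtain ⟨r, hr⟩ := Nat.not_odd_iff_even.mp hso
    have hr0 : 0 < r := by omega
    have c2 := card_filter_pow_card_eq_self hq hK (2 * g) (by omega)
    have c4 := card_filter_pow_card_eq_self hq hK (4 * g) (by omega)
    have ce := card_filter_pow_card_eq_self hq hK (2 * (g * f)) (by positivity)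
    rw [Nat.gcd_eq_right (Dvd.intro _ rfl)] at c2
    rw [Nat.gcd_eq_right ⟨r, by rw [hr]; ring⟩] at c4
    rw [(by ring : 2 * (g * f) = 2 * g * f), Nat.gcd_mul_left, hsf, mul_one] at ce
    -- For s even, K contains the field with q^(4g) elements, which is larger than the one with
    -- q^(2g). On it the q^(2g)-power map is an involution, and x^(q^(2g)) - x is a nonzero element
    -- that it negates.
    obtain ⟨x, hx4, hx2⟩ : ∃ x : K, x ^ q ^ (4 * g) = x ∧ x ^ q ^ (2 * g) ≠ x := by
      by_contra! hcon
      have : univ.filter (fun x : K => x ^ q ^ (4 * g) = x)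
          ⊆ univ.filter (fun x : K => x ^ q ^ (2 * g) = x) := by
        intro x hx
        simp only [mem_filter, mem_univ, true_and] at hx ⊢
        exact hcon x hx
      have := card_le_card this
      rw [c2, c4] at this
      have h3 := Nat.pow_lt_pow_right hq (by omega : 2 * g < 4 * g)
      omega
    obtain ⟨y, hy0, hy⟩ : ∃ y : K, y ≠ 0 ∧ y ^ q ^ (2 * (g * f)) = -y := by
      refine ⟨x ^ q ^ (2 * g) - x, sub_ne_zero.mpr hx2, ?_⟩
      rw [← mul_assoc, pow_mul q (2 * g) f]
      refine pow_pow_odd_eq_neg hqo.pow ?_ hf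
      have hsub : ∀ a b : K, (a - b) ^ q ^ (2 * g) = a ^ q ^ (2 * g) - b ^ q ^ (2 * g) := by
        intro a b
        rw [hqp, ← pow_mul]
        exact sub_pow_char_pow a b _
      rw [hsub, ← pow_mul, ← pow_add, (by ring : 2 * g + 2 * g = 4 * g), hx4, neg_sub]
    rw [← ce, (by ring : 2 * (g * f) = 2 * g * f)]
    rw [(by ring : 2 * (g * f) = 2 * g * f)] at hy
    -- One nonzero solution y identifies all solutions with the fixed field, of order q^(2g) because
    -- gcd(2gs, 2gf) = 2g.
    refine card_bij' (fun x _ => x * y⁻¹) (fun x _ => x * y) ?_ ?_ ?_ ?_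
    · intro x hx
      simp only [mem_filter, mem_univ, true_and] at hx ⊢
      rw [mul_pow, inv_pow, hx, hy]
      field_simp
    · intro x hx
      simp only [mem_filter, mem_univ, true_and] at hx ⊢
      rw [mul_pow, hx, hy]
      ring
    · intro x _
      field_simp
    · intro x _
      field_simp

end FrobeniusFixedPoints

/-! ### The form Tr(x^(q^e+1)), its polar form and its radical -/

section PowForm

open Finset QuadraticMap

variable (F K : Type*) [Field F] [Field K] [Fintype F] [Algebra F K]

theorem frobeniusAlgHom_pow_apply (e : ℕ) (x : K) :
    ((FiniteField.frobeniusAlgHom F K) ^ e) x = x ^ Fintype.card F ^ e := by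
  rw [AlgHom.coe_pow, FiniteField.coe_frobeniusAlgHom, pow_iterate]

/-- The quadratic form `x ↦ Tr (x ^ (q ^ e + 1))`. -/
noncomputable def powForm (e : ℕ) : QuadraticForm F K :=
  LinearMap.BilinMap.toQuadraticMap
    ((Algebra.traceForm F K) ∘ₗ ((FiniteField.frobeniusAlgHom F K) ^ e).toLinearMap)

variable {F K}

theorem powForm_apply (e : ℕ) (x : K) :
    powForm F K e x = Algebra.trace F K (x ^ (Fintype.card F ^ e + 1)) := by
  rw [powForm, LinearMap.BilinMap.toQuadraticMap_apply, LinearMap.comp_apply,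
    AlgHom.toLinearMap_apply, frobeniusAlgHom_pow_apply, Algebra.traceForm_apply, pow_succ]

theorem polar_powForm (e : ℕ) (x y : K) :
    polar (powForm F K e) x y
      = Algebra.trace F K (x ^ Fintype.card F ^ e * y + y ^ Fintype.card F ^ e * x) := by
  rw [powForm, LinearMap.BilinMap.polar_toQuadraticMap]
  simp only [LinearMap.comp_apply, AlgHom.toLinearMap_apply, frobeniusAlgHom_pow_apply,
    Algebra.traceForm_apply, map_add]

variable [Fintype K]

theorem trace_pow_card_pow (e : ℕ) (x : K) :
    Algebra.trace F K (x ^ Fintype.card F ^ e) = Algebra.trace F K x := by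
  induction e with
  | zero => simp
  | succ e ih =>
    rw [pow_succ, pow_mul, ← ih]
    exact Algebra.trace_eq_of_algEquiv (FiniteField.frobeniusAlgEquivOfAlgebraic F K) _

theorem trace_mul_eq_zero {y : K} (h : ∀ x : K, Algebra.trace F K (x * y) = 0) : y = 0 := by
  by_contra hy
  obtain ⟨z, hz⟩ := Algebra.trace_surjective F K 1
  have := h (z * y⁻¹)
  rw [inv_mul_cancel_right₀ hy, hz] at this
  exact one_ne_zero this

/-- Frobenius fixes 1 and preserves the trace. This is what makes the condition Tr x = 0 an
orthogonality condition. -/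
theorem polar_powForm_one (e : ℕ) (x : K) :
    polar (powForm F K e) x 1 = 2 * Algebra.trace F K x := by
  rw [polar_powForm, map_add, mul_one, one_pow, one_mul, trace_pow_card_pow, two_mul]

theorem powForm_one (e : ℕ) : powForm F K e 1 = Module.finrank F K := by
  rw [powForm_apply, one_pow, ← map_one (algebraMap F K), Algebra.trace_algebraMap, nsmul_eq_mul,
    mul_one]

/-- Applying the e-th Frobenius power inside the trace to the second term makes x^(q^e) a common
factor. It runs through all of K, so nondegeneracy of the trace form applies. -/
theorem polar_powForm_eq_zero_iff (e : ℕ) (y : K) :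
    (∀ x, polar (powForm F K e) x y = 0) ↔ y ^ Fintype.card F ^ (2 * e) = -y := by
  have h1 : ∀ x, polar (powForm F K e) x y
      = Algebra.trace F K (x ^ Fintype.card F ^ e * (y ^ Fintype.card F ^ (2 * e) + y)) := by
    intro x
    rw [polar_powForm, map_add, ← trace_pow_card_pow e (y ^ Fintype.card F ^ e * x), ← map_add,
      mul_pow, ← pow_mul y, ← pow_add, ← two_mul e]
    congr 1
    ring
  simp_rw [h1]
  constructor
  · intro h
    rw [eq_neg_iff_add_eq_zero]
    refine trace_mul_eq_zero (F := F) fun x => ?_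
    have hs : Function.Surjective (fun x : K => x ^ Fintype.card F ^ e) := by
      have := (frobeniusAlgHom_pow_apply F K e)
      rw [← funext this]
      exact (((FiniteField.frobeniusAlgHom F K) ^ e).bijective).2
    obtain ⟨z, rfl⟩ := hs x
    exact h z
  · intro h x
    rw [h]
    simp

end PowForm

/-! ### Equidistribution of nonzero values and the sign of the exponential sum -/

section PowFormSum

open Finset QuadraticMap

variable {F K : Type*} [Field F] [Field K] [Fintype F] [Algebra F K]

theorem powForm_mul {e : ℕ} {a x : K} {c : F}
    (ha : a ^ (Fintype.card F ^ e + 1) = algebraMap F K c) :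
    powForm F K e (a * x) = c * powForm F K e x := by
  rw [powForm_apply, powForm_apply, mul_pow, ha, ← Algebra.smul_def, map_smul, smul_eq_mul]

variable [Fintype K] [DecidableEq K]

theorem pow_add_one_mul_sub_one_dvd (q g s : ℕ) :
    (q ^ g + 1) * (q - 1) ∣ q ^ (2 * g * s) - 1 := by
  have h1 : (q ^ g + 1) * (q - 1) ∣ q ^ (2 * g) - 1 := by
    rw [mul_comm 2, pow_mul, ← one_pow 2, Nat.sq_sub_sq]
    refine mul_dvd_mul_left _ ?_
    have := Nat.sub_dvd_pow_sub_pow q 1 g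
    rwa [one_pow] at this
  have h2 := Nat.sub_dvd_pow_sub_pow (q ^ (2 * g)) 1 s
  rw [one_pow, ← pow_mul] at h2
  exact h1.trans h2

theorem pow_add_one_dvd_pow_sub_one (q g s : ℕ) : q ^ g + 1 ∣ q ^ (2 * g * s) - 1 :=
  (Dvd.intro _ rfl).trans (pow_add_one_mul_sub_one_dvd q g s)

/-- Every nonzero element of `F` is a `(q ^ e + 1)`-th power in `K`. -/
theorem exists_pow_eq_algebraMap {g s f : ℕ}
    (hK : Fintype.card K = Fintype.card F ^ (2 * g * s)) (hf : Odd f) {c : F} (hc : c ≠ 0) :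
    ∃ x : K, x ^ (Fintype.card F ^ (g * f) + 1) = algebraMap F K c := by
  set q := Fintype.card F with hq
  have hc' : algebraMap F K c ≠ 0 := by simpa using hc
  obtain ⟨k, hk⟩ := pow_add_one_mul_sub_one_dvd q g s
  -- First solve with exponent q^g + 1. As c is fixed by Frobenius, x turns out to be fixed by the
  -- q^(2g)-power map; since f is odd, gf ≡ g mod 2g, so the same x works for q^(gf) + 1.
  obtain ⟨x, hx⟩ := exists_pow_eq_of_pow_eq_one (K := K) (n := q ^ g + 1) (k := (q - 1) * k)
    (by rw [hK, hk, mul_assoc]) hc' (by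
      rw [pow_mul, ← map_pow, FiniteField.pow_card_sub_one_eq_one c hc, map_one, one_pow])
  have hx0 : x ≠ 0 := by
    rintro rfl
    rw [zero_pow (by omega)] at hx
    exact hc' hx.symm
  refine ⟨x, ?_⟩
  have hfix : x ^ q ^ (2 * g) = x := by
    have h1 := congrArg (· ^ q ^ g) hx
    simp only [← map_pow, hq, FiniteField.pow_card_pow] at h1
    rw [← hq, ← hx, ← pow_mul, add_mul, ← pow_add, one_mul, ← two_mul, pow_add, pow_succ,
      mul_comm] at h1
    exact mul_left_cancel₀ (pow_ne_zero _ hx0) h1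
  obtain ⟨i, rfl⟩ := hf
  rw [← hx, pow_succ, pow_succ]
  congr 1
  rw [(by ring : g * (2 * i + 1) = 2 * g * i + g), pow_add, pow_mul, pow_mul q (2 * g) i,
    pow_pow_mul_eq_self hfix]

variable [DecidableEq F]

/-- If a^(q^e+1) = c, then multiplication by a multiplies the form by c and carries one level set
onto the other. -/
theorem card_powForm_eq {g s f : ℕ}
    (hK : Fintype.card K = Fintype.card F ^ (2 * g * s)) (hf : Odd f) (c : F) (hc : c ≠ 0) :
    #{x | powForm F K (g * f) x = c} = #{x | powForm F K (g * f) x = 1} := by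
  obtain ⟨a, ha⟩ := exists_pow_eq_algebraMap hK hf hc
  have ha0 : a ≠ 0 := by
    rintro rfl
    rw [zero_pow (by omega), eq_comm, map_eq_zero] at ha
    exact hc ha
  symm
  refine card_bij' (fun x _ => a * x) (fun x _ => a⁻¹ * x) ?_ ?_ ?_ ?_
  · intro x hx
    simp only [mem_filter, mem_univ, true_and] at hx ⊢
    rw [powForm_mul ha, hx, mul_one]
  · intro x hx
    simp only [mem_filter, mem_univ, true_and] at hx ⊢
    refine mul_left_cancel₀ hc ?_
    rw [← powForm_mul ha, mul_inv_cancel_left₀ ha0, hx, mul_one]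
  · intro x _
    simp [ha0]
  · intro x _
    simp [ha0]

/-- The values of the form are invariant under the `(q ^ e + 1)`-th roots of unity. -/
theorem gcd_dvd_card_powForm_eq_one (e : ℕ) :
    Nat.gcd (Fintype.card K - 1) (Fintype.card F ^ e + 1) ∣ #{x | powForm F K e x = 1} := by
  -- The form depends on x only through x^(q^e+1), and each nonempty fibre of that power map here is
  -- a coset of the (q^e+1)-th roots of unity.
  rw [card_eq_sum_card_fiberwise (f := fun x => x ^ (Fintype.card F ^ e + 1)) (t := univ)
    (fun _ _ => mem_univ _)]
  refine dvd_sum fun v _ => ?_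
  rcases Finset.eq_empty_or_nonempty
    {x ∈ ({x | powForm F K e x = 1} : Finset K) | x ^ (Fintype.card F ^ e + 1) = v} with h | h
  · rw [h]
    simp
  · obtain ⟨a, ha⟩ := h
    simp only [mem_filter, mem_univ, true_and] at ha
    obtain ⟨ha1, rfl⟩ := ha
    have ha0 : a ≠ 0 := by
      rintro rfl
      simp at ha1
    rw [← card_filter_pow_eq_one _ (by omega)]
    refine dvd_of_eq ?_
    refine card_bij' (fun x _ => x * a) (fun x _ => x * a⁻¹) ?_ ?_ ?_ ?_
    · intro x hx
      simp only [mem_filter, mem_univ, true_and] at hx ⊢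
      rw [powForm_apply] at ha1 ⊢
      rw [mul_pow, hx, one_mul]
      exact ⟨ha1, rfl⟩
    · intro x hx
      simp only [mem_filter, mem_univ, true_and] at hx ⊢
      rw [mul_pow, hx.2, inv_pow, mul_inv_cancel₀ (pow_ne_zero _ ha0)]
    · intro x _
      simp [ha0]
    · intro x _
      simp [ha0]

/-- The form `Tr (x ^ (q ^ e + 1))` is of minus type. -/
theorem zeroExcess_powForm {g s f t : ℕ} (h2 : (2 : F) ≠ 0)
    (hK : Fintype.card K = Fintype.card F ^ (2 * g * s)) (hg : 0 < g) (hf : Odd f) (ht : Odd t)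
    (hrad : Fintype.card F ^ (2 * g * s) * #{y : K | ∀ x, polar (powForm F K (g * f)) x y = 0}
      = Fintype.card F ^ (2 * (g * t))) :
    zeroExcess (powForm F K (g * f)) = -(Fintype.card F : ℤ) ^ (g * t) := by
  have hQ := card_powForm_eq hK hf
  have hsq := zeroExcess_sq h2 hQ
  rw [hK] at hsq
  set q := Fintype.card F with hq
  have hq2 : 2 < q := by
    have h1 : 1 < q := Fintype.one_lt_card
    have h3 : q ≠ 2 := by
      intro h
      apply h2
      have := Nat.cast_card_eq_zero (R := F)
      rw [← hq, h] at this
      exact_mod_cast this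
    omega
  have hsq' : zeroExcess (powForm F K (g * f)) ^ 2 = ((q : ℤ) ^ (g * t)) ^ 2 := by
    rw [hsq, ← pow_mul, mul_comm (g * t)]
    exact_mod_cast hrad
  rcases sq_eq_sq_iff_eq_or_eq_neg.mp hsq' with h | h
  -- With the plus sign q N₁ = q^(2gs) - q^(gt), where N₁ counts the solutions of Q = 1. Now q^g + 1
  -- divides N₁ (f is odd), q^(gt) + 1 (t is odd) and q^(2gs) - 1, hence it divides 2, which is
  -- impossible.
  · exfalso
    have hone := card_mul_card_eq_one hQ
    rw [h, hK, ← hq] at hone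
    have d1 : q ^ g + 1 ∣ #{x | powForm F K (g * f) x = 1} := by
      refine dvd_trans (Nat.dvd_gcd ?_ ?_) (gcd_dvd_card_powForm_eq_one (g * f))
      · rw [hK]
        exact pow_add_one_dvd_pow_sub_one _ _ _
      · rw [← hq, pow_mul]
        simpa using hf.nat_add_dvd_pow_add_pow (x := q ^ g) (y := 1)
    have d2 : q ^ g + 1 ∣ q ^ (g * t) + 1 := by
      rw [pow_mul]
      simpa using ht.nat_add_dvd_pow_add_pow (x := q ^ g) (y := 1)
    have d3 : q ^ g + 1 ∣ q ^ (2 * g * s) - 1 := pow_add_one_dvd_pow_sub_one _ _ _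
    have hpos : 1 ≤ q ^ (2 * g * s) := Nat.one_le_pow _ _ (by omega)
    zify [hpos] at d1 d2 d3
    have d4 : (q : ℤ) ^ g + 1 ∣ 2 := by
      have := (dvd_sub d2 d3).add (d1.mul_left (q : ℤ))
      rw [hone] at this
      push_cast at this
      ring_nf at this ⊢
      exact this
    have h5 := Int.le_of_dvd (by norm_num) d4
    have h6 : (q : ℤ) ≤ q ^ g := by
      exact_mod_cast Nat.le_self_pow hg.ne' q
    omega
  · exact h

end PowFormSum

/-! ### Counting values of binary quadratic forms -/

section BinaryForms

open Finset

theorem card_filter_prod_eq_sum {α : Type*} [Fintype α] [DecidableEq α] (P : α → α → Prop)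
    [∀ s z, Decidable (P s z)] :
    #{c : α × α | P c.1 c.2} = ∑ z, #{s | P s z} := by
  rw [card_eq_sum_card_fiberwise (f := Prod.snd) (t := univ) (fun _ _ => mem_univ _)]
  refine sum_congr rfl fun z _ => ?_
  refine card_bij' (fun c _ => c.1) (fun s _ => (s, z)) ?_ ?_ ?_ ?_ <;> simp +contextual
  rintro a b h rfl
  exact h

variable {F : Type*} [Field F] [Fintype F] [DecidableEq F]

theorem card_filter_sq_eq (hF : ringChar F ≠ 2) (a : F) :
    (#{x : F | x ^ 2 = a} : ℤ) = quadraticChar F a + 1 := by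
  rw [← quadraticChar_card_sqrts hF a]
  congr 2
  ext x
  simp

theorem card_filter_mul_sq_eq (hF : ringChar F ≠ 2) {m : F} (hm : m ≠ 0) (v : F) :
    (#{x : F | m * x ^ 2 = v} : ℤ) = 1 + quadraticChar F (m * v) := by
  have h1 : univ.filter (fun x : F => m * x ^ 2 = v) = univ.filter fun x : F => x ^ 2 = v / m := by
    ext x
    simp only [mem_filter, mem_univ, true_and]
    rw [eq_div_iff hm, mul_comm]
  have h2 : quadraticChar F (m * v) = quadraticChar F (v / m) := by
    have : m * v = v / m * m ^ 2 := by field_simp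
    rw [this, map_mul, quadraticChar_sq_one' hm, mul_one]
  rw [h1, card_filter_sq_eq hF, h2, add_comm]

/-- A sum over squares in terms of the quadratic character. -/
theorem sum_comp_sq (hF : ringChar F ≠ 2) (f : F → ℤ) :
    ∑ z : F, f (z ^ 2) = ∑ b, (quadraticChar F b + 1) * f b := by
  rw [← sum_fiberwise univ (fun z : F => z ^ 2)]
  refine sum_congr rfl fun b _ => ?_
  rw [← card_filter_sq_eq hF, ← nsmul_eq_mul, ← sum_const]
  refine sum_congr rfl fun z hz => ?_
  rw [(mem_filter.mp hz).2]

/-- Written as a sum over b = z² with weight χ(b) + 1, the constant weight contributes 0, and the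
weight χ(b) gives, after b = -(v/d) x, a multiple of the Jacobi sum J(χ, χ) = -χ(-1). -/
theorem sum_quadraticChar_add_mul_sq (hF : ringChar F ≠ 2) {d v : F} (hd : d ≠ 0) (hv : v ≠ 0) :
    ∑ z : F, quadraticChar F (v + d * z ^ 2) = -quadraticChar F d := by
  rw [sum_comp_sq hF (fun b => quadraticChar F (v + d * b))]
  have h1 : ∑ b, quadraticChar F (v + d * b) = 0 := by
    rw [← quadraticChar_sum_zero hF]
    exact Equiv.sum_comp ((Equiv.mulLeft₀ d hd).trans (Equiv.addLeft v))
      (fun x => quadraticChar F x)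
  have h2 : ∑ b, quadraticChar F b * quadraticChar F (v + d * b) = -quadraticChar F d := by
    have hJ := jacobiSum_nontrivial_inv (quadraticChar_ne_one hF)
    rw [(quadraticChar_isQuadratic F).inv, jacobiSum] at hJ
    have hvd : -v / d ≠ 0 := div_ne_zero (neg_ne_zero.mpr hv) hd
    rw [← Equiv.sum_comp (Equiv.mulLeft₀ (-v / d) hvd)]
    have h3 : ∀ x, quadraticChar F (Equiv.mulLeft₀ (-v / d) hvd x)
        * quadraticChar F (v + d * Equiv.mulLeft₀ (-v / d) hvd x)
        = quadraticChar F (-d) * (quadraticChar F x * quadraticChar F (1 - x)) := by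
      intro x
      rw [← map_mul, ← map_mul, ← map_mul]
      have : (Equiv.mulLeft₀ (-v / d) hvd x) * (v + d * Equiv.mulLeft₀ (-v / d) hvd x)
          = (-d * (x * (1 - x))) * (v / d) ^ 2 := by
        change -v / d * x * (v + d * (-v / d * x)) = _
        field_simp
        ring
      rw [this, map_mul, quadraticChar_sq_one' (div_ne_zero hv hd), mul_one]
    simp_rw [h3]
    rw [← mul_sum, hJ, mul_neg, ← map_mul]
    simp
  simp_rw [add_mul, one_mul]
  rw [sum_add_distrib, h1, h2, add_zero]

/-- The number of solutions of `s² - d z² = v`. -/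
theorem card_filter_sq_sub_mul_sq (hF : ringChar F ≠ 2) (d v : F) :
    (#{c : F × F | c.1 ^ 2 - d * c.2 ^ 2 = v} : ℤ)
      = Fintype.card F + ∑ z, quadraticChar F (v + d * z ^ 2) := by
  rw [card_filter_prod_eq_sum (fun s z => s ^ 2 - d * z ^ 2 = v)]
  push_cast
  simp_rw [sub_eq_iff_eq_add, card_filter_sq_eq hF]
  rw [sum_add_distrib, add_comm]
  simp

/-- Completing the square: with s = m t + z T, m times the form is s² - (T² - mY) z². -/
theorem card_binary_eq (hF : ringChar F ≠ 2) {m : F} (hm : m ≠ 0) (T Y v : F) :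
    (#{c : F × F | m * c.1 ^ 2 + 2 * c.1 * c.2 * T + c.2 ^ 2 * Y = v} : ℤ)
      = Fintype.card F + ∑ z, quadraticChar F (m * v + (T ^ 2 - m * Y) * z ^ 2) := by
  rw [← card_filter_sq_sub_mul_sq hF]
  congr 1
  refine card_bij' (fun c _ => (m * c.1 + c.2 * T, c.2)) (fun c _ => ((c.1 - c.2 * T) / m, c.2))
    ?_ ?_ ?_ ?_
  · intro c hc
    simp only [mem_filter, mem_univ, true_and] at hc ⊢
    linear_combination m * hc
  · intro c hc
    simp only [mem_filter, mem_univ, true_and] at hc ⊢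
    field_simp
    linear_combination hc
  · intro c _
    ext <;> simp [hm]
  · intro c _
    ext <;> simp
    field_simp
    ring

theorem card_binary_of_disc_eq_zero (hF : ringChar F ≠ 2) {m : F} (hm : m ≠ 0) {T Y : F} (v : F)
    (hd : T ^ 2 - m * Y = 0) :
    (#{c : F × F | m * c.1 ^ 2 + 2 * c.1 * c.2 * T + c.2 ^ 2 * Y = v} : ℤ)
      = Fintype.card F * (1 + quadraticChar F (m * v)) := by
  rw [card_binary_eq hF hm, hd]
  simp
  ring

theorem card_binary_zero (hF : ringChar F ≠ 2) {m : F} (hm : m ≠ 0) {T Y : F} :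
    (#{c : F × F | m * c.1 ^ 2 + 2 * c.1 * c.2 * T + c.2 ^ 2 * Y = 0} : ℤ)
      = Fintype.card F + (Fintype.card F - 1) * quadraticChar F (T ^ 2 - m * Y) := by
  rw [card_binary_eq hF hm, ← add_sum_erase _ _ (mem_univ 0)]
  have : ∀ z ∈ univ.erase (0 : F), quadraticChar F (m * 0 + (T ^ 2 - m * Y) * z ^ 2)
      = quadraticChar F (T ^ 2 - m * Y) := by
    intro z hz
    rw [mul_zero, zero_add, map_mul, quadraticChar_sq_one' (ne_of_mem_erase hz), mul_one]
  rw [sum_congr rfl this, sum_const, card_erase_of_mem (mem_univ _), card_univ, nsmul_eq_mul,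
    Nat.cast_sub Fintype.card_pos]
  simp

theorem card_binary_of_ne_zero (hF : ringChar F ≠ 2) {m : F} (hm : m ≠ 0) {T Y v : F} (hv : v ≠ 0)
    (hd : T ^ 2 - m * Y ≠ 0) :
    (#{c : F × F | m * c.1 ^ 2 + 2 * c.1 * c.2 * T + c.2 ^ 2 * Y = v} : ℤ)
      = Fintype.card F - quadraticChar F (T ^ 2 - m * Y) := by
  rw [card_binary_eq hF hm, sum_quadraticChar_add_mul_sq hF hd (mul_ne_zero hm hv)]
  ring

/-- For each z ≠ 0 the equation is linear in t with exactly one solution; for z = 0 every t or no t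
works, according to whether v = 0. -/
theorem card_binary_hyperbolic (h2 : (2 : F) ≠ 0) {T : F} (hT : T ≠ 0) (Y v : F) :
    (#{c : F × F | 0 * c.1 ^ 2 + 2 * c.1 * c.2 * T + c.2 ^ 2 * Y = v} : ℤ)
      = (if v = 0 then (Fintype.card F : ℤ) else 0) + (Fintype.card F - 1) := by
  rw [card_filter_prod_eq_sum (fun t z => 0 * t ^ 2 + 2 * t * z * T + z ^ 2 * Y = v),
    ← add_sum_erase _ _ (mem_univ 0)]
  have : ∀ z ∈ univ.erase (0 : F), #{t | 0 * t ^ 2 + 2 * t * z * T + z ^ 2 * Y = v} = 1 := by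
    intro z hz
    have hz := ne_of_mem_erase hz
    rw [card_eq_one]
    refine ⟨(v - z ^ 2 * Y) / (2 * z * T), ?_⟩
    ext t
    simp only [mem_filter, mem_univ, true_and, mem_singleton]
    rw [eq_div_iff (by positivity)]
    constructor <;> intro h <;> linear_combination h
  rw [sum_congr rfl this, sum_const, card_erase_of_mem (mem_univ _), card_univ, smul_eq_mul,
    mul_one]
  push_cast [Fintype.card_pos (α := F)]
  congr 1
  by_cases hv : v = 0
  · simp [hv]
  · simp [hv, Ne.symm hv]

theorem card_binary_rank_one (hF : ringChar F ≠ 2) {Y : F} (hY : Y ≠ 0) (v : F) :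
    (#{c : F × F | 0 * c.1 ^ 2 + 2 * c.1 * c.2 * 0 + c.2 ^ 2 * Y = v} : ℤ)
      = Fintype.card F * (1 + quadraticChar F (Y * v)) := by
  rw [← card_filter_mul_sq_eq hF hY]
  simp only [zero_mul, mul_zero, zero_add]
  rw [← Nat.cast_mul, ← card_univ, ← card_product]
  congr 2
  ext c
  simp [mul_comm]

theorem card_binary_rank_zero (v : F) :
    (#{c : F × F | 0 * c.1 ^ 2 + 2 * c.1 * c.2 * 0 + c.2 ^ 2 * 0 = v} : ℤ)
      = if v = 0 then (Fintype.card F : ℤ) ^ 2 else 0 := by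
  by_cases hv : v = 0
  · simp [hv, sq]
  · simp [hv, Ne.symm hv]

/-- For c ≠ 0 the number 1 + i χ(ac) is 2 or 0, according to whether χ(ac) = i, and χ sums to zero.
-/
theorem two_mul_card_quadraticChar_eq (hF : ringChar F ≠ 2) {a : F} (ha : a ≠ 0) {i : ℤ}
    (hi : i = 1 ∨ i = -1) :
    2 * (#{c : F | quadraticChar F (a * c) = i} : ℤ) = Fintype.card F - 1 := by
  have h0 : ∑ c, quadraticChar F (a * c) = 0 := by
    rw [← quadraticChar_sum_zero hF]
    exact Equiv.sum_comp (Equiv.mulLeft₀ a ha) (fun x => quadraticChar F x)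
  have h1 : ∀ c ∈ univ.erase (0 : F), (1 + i * quadraticChar F (a * c))
      = if quadraticChar F (a * c) = i then 2 else 0 := by
    intro c hc
    rcases quadraticChar_dichotomy (mul_ne_zero ha (ne_of_mem_erase hc)) with h | h <;>
    rcases hi with rfl | rfl <;> simp [h]
  have h2 := sum_congr rfl h1
  rw [sum_add_distrib, ← mul_sum, ← sum_filter, sum_const, sum_const,
    card_erase_of_mem (mem_univ _)] at h2
  rw [← add_sum_erase _ _ (mem_univ 0)] at h0
  simp only [mul_zero, MulChar.map_zero, zero_add] at h0
  rw [h0, card_univ, nsmul_eq_mul, nsmul_eq_mul, Nat.cast_sub Fintype.card_pos] at h2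
  have h3 : (univ.erase (0 : F)).filter (fun c => quadraticChar F (a * c) = i)
      = univ.filter fun c => quadraticChar F (a * c) = i := by
    ext c
    simp only [mem_filter, mem_erase, mem_univ, and_true, true_and, and_iff_right_iff_imp]
    rintro h rfl
    rw [mul_zero, MulChar.map_zero] at h
    omega
  rw [h3] at h2
  push_cast at h2
  linarith

end BinaryForms

/-! ### Fibres of linear maps -/

section LinearFibres

open Finset

variable {F V W : Type*} [Field F] [AddCommGroup V] [Module F V] [AddCommGroup W] [Module F W]
  [Fintype V] [DecidableEq W]

/-- Nonempty fibres are cosets of the kernel. This converts counts of b into counts of codewords,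
and counts of y into counts of b = A(y). -/
theorem card_filter_comp_linearMap (f : V →ₗ[F] W) (P : W → Prop) [DecidablePred P] :
    #{v | P (f v)} = #{v | f v = 0} * Set.ncard {c | c ∈ LinearMap.range f ∧ P c} := by
  classical
  have h1 : {c | c ∈ LinearMap.range f ∧ P c}
      = ((({v | P (f v)} : Finset V).image f : Finset W) : Set W) := by
    ext c
    simp only [Set.mem_ofPred_eq, LinearMap.mem_range, coe_image, coe_filter, mem_univ, true_and,
      Set.mem_image]
    constructor
    · rintro ⟨⟨v, rfl⟩, h⟩
      exact ⟨v, h, rfl⟩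
    · rintro ⟨v, h, rfl⟩
      exact ⟨⟨v, rfl⟩, h⟩
  rw [h1, Set.ncard_coe_finset, card_eq_sum_card_image f, mul_comm, ← smul_eq_mul, ← sum_const]
  refine sum_congr rfl fun c hc => ?_
  obtain ⟨v, hv, rfl⟩ := mem_image.mp hc
  simp only [mem_filter, mem_univ, true_and] at hv
  refine card_bij' (fun x _ => x - v) (fun x _ => x + v) ?_ ?_ ?_ ?_
  · intro x hx
    simp only [mem_filter, mem_univ, true_and] at hx ⊢
    rw [map_sub, hx.2, sub_self]
  · intro x hx
    simp only [mem_filter, mem_univ, true_and] at hx ⊢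
    rw [map_add, hx, zero_add]
    exact ⟨hv, rfl⟩
  · intro x _
    simp
  · intro x _
    simp

end LinearFibres

/-! ### From a three-valued weight function to the code parameters -/

section WeightPackage

open Finset

variable {F K : Type*} [Field F] [Field K] [Fintype F] [Fintype K] [DecidableEq F]
  [Algebra F K]

/-- The parameters of a trace code whose words have three nonzero weights. -/
theorem traceCode_of_three_weights (D : Finset K) {r₁ r₂ r₃ a₁ a₂ a₃ : ℚ}
    (h₁₂ : r₁ ≠ r₂) (h₁₃ : r₁ ≠ r₃) (h₂₃ : r₂ ≠ r₃) (h₁ : r₁ ≠ 0) (h₂ : r₂ ≠ 0) (h₃ : r₃ ≠ 0)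
    (ha₁ : 0 < a₁) (ha₂ : 0 < a₂) (ha₃ : 0 < a₃)
    (hw : ∀ b : K, (hammingNorm (traceWord F D b) : ℚ) = 0 ∨
      (hammingNorm (traceWord F D b) : ℚ) = r₁ ∨ (hammingNorm (traceWord F D b) : ℚ) = r₂ ∨
      (hammingNorm (traceWord F D b) : ℚ) = r₃)
    (hc₁ : (#{b : K | (hammingNorm (traceWord F D b) : ℚ) = r₁} : ℚ) = Fintype.card F * a₁)
    (hc₂ : (#{b : K | (hammingNorm (traceWord F D b) : ℚ) = r₂} : ℚ) = Fintype.card F * a₂)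
    (hc₃ : (#{b : K | (hammingNorm (traceWord F D b) : ℚ) = r₃} : ℚ) = Fintype.card F * a₃)
    (hsum : (Fintype.card F : ℚ) * (1 + a₁ + a₂ + a₃) = Fintype.card K) :
    IsWeightCode 3 (traceCode F D) ∧
    Module.finrank F (traceCode F D) = Module.finrank F K - 1 ∧
    HasWeightDistribution (traceCode F D) [(0, 1), (r₁, a₁), (r₂, a₂), (r₃, a₃)] ∧
    ∀ r, (r = r₁ ∨ r = r₂ ∨ r = r₃) → r ≤ r₁ → r ≤ r₂ → r ≤ r₃ →
      ∃ d : ℕ, (d : ℚ) = r ∧ HasMinDistance (traceCode F D) d := by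
  classical
  set N : K → ℕ := fun b => hammingNorm (traceWord F D b) with hN
  have hq : (0 : ℚ) < Fintype.card F := by exact_mod_cast Fintype.card_pos
  -- The kernel is found by subtraction: the three nonzero weights account for all but q of the
  -- elements b. So the kernel is a line, and each codeword arises from q values of b.
  have hker : #{b : K | traceWord F D b = 0} = Fintype.card F := by
    have e0 : univ.filter (fun b : K => traceWord F D b = 0)
        = univ.filter fun b : K => (N b : ℚ) = 0 := by
      ext b
      simp [hN]
    have hcard : (Fintype.card K : ℚ) = #{b : K | (N b : ℚ) = 0} + #{b : K | (N b : ℚ) = r₁}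
        + #{b : K | (N b : ℚ) = r₂} + #{b : K | (N b : ℚ) = r₃} := by
      have : ∀ b : K, (1 : ℚ) = (if (N b : ℚ) = 0 then 1 else 0)
          + (if (N b : ℚ) = r₁ then 1 else 0) + (if (N b : ℚ) = r₂ then 1 else 0)
          + (if (N b : ℚ) = r₃ then 1 else 0) := by
        intro b
        rcases hw b with h | h | h | h <;> change (N b : ℚ) = _ at h <;> rw [h] <;>
          simp [h₁, h₂, h₃, h₁₂, h₁₃, h₂₃, h₁.symm, h₂.symm, h₃.symm, h₁₂.symm, h₁₃.symm, h₂₃.symm]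
      rw [← card_univ, card_eq_sum_ones]
      push_cast
      rw [sum_congr rfl fun b _ => this b]
      simp only [sum_add_distrib, sum_boole]
    rw [hc₁, hc₂, hc₃, ← hsum] at hcard
    rw [e0]
    have : (#{b : K | (N b : ℚ) = 0} : ℚ) = Fintype.card F := by linear_combination -hcard
    exact_mod_cast this
  have hcount : ∀ w : ℕ, (#{b : K | (N b : ℚ) = w} : ℚ)
      = Fintype.card F * weightCount (traceCode F D) w := by
    intro w
    have := card_filter_comp_linearMap (traceWord F D) (fun c => hammingNorm c = w)
    rw [hker] at this
    simp only [weightCount, traceCode]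
    rw [← Nat.cast_mul, ← this]
    simp only [hN, Nat.cast_inj]
  have hval : ∀ w : ℕ, ∀ r a : ℚ, (w : ℚ) = r → (#{b : K | (N b : ℚ) = r} : ℚ)
      = Fintype.card F * a → (weightCount (traceCode F D) w : ℚ) = a := by
    intro w r a hwr hc
    have := hcount w
    rw [hwr, hc] at this
    exact (mul_left_cancel₀ hq.ne' this).symm
  have hex : ∀ r a : ℚ, 0 < a → (#{b : K | (N b : ℚ) = r} : ℚ) = Fintype.card F * a →
      ∃ b : K, (N b : ℚ) = r := by
    intro r a ha hc
    have : (0 : ℚ) < #{b : K | (N b : ℚ) = r} := by rw [hc]; positivity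
    have : 0 < #{b : K | (N b : ℚ) = r} := by exact_mod_cast this
    obtain ⟨b, hb⟩ := card_pos.mp this
    exact ⟨b, (mem_filter.mp hb).2⟩
  obtain ⟨b₁, hb₁⟩ := hex _ _ ha₁ hc₁
  obtain ⟨b₂, hb₂⟩ := hex _ _ ha₂ hc₂
  obtain ⟨b₃, hb₃⟩ := hex _ _ ha₃ hc₃
  have hv₁ := hval _ _ _ hb₁ hc₁
  have hv₂ := hval _ _ _ hb₂ hc₂
  have hv₃ := hval _ _ _ hb₃ hc₃
  have hnone : ∀ w : ℕ, (w : ℚ) ≠ 0 → (w : ℚ) ≠ r₁ → (w : ℚ) ≠ r₂ → (w : ℚ) ≠ r₃ →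
      weightCount (traceCode F D) w = 0 := by
    intro w g0 g1 g2 g3
    have h := hcount w
    have he : univ.filter (fun b : K => (N b : ℚ) = w) = ∅ := by
      ext b
      simp only [mem_filter, mem_univ, true_and, notMem_empty, iff_false]
      intro hb
      have := hw b
      change (N b : ℚ) = 0 ∨ (N b : ℚ) = r₁ ∨ (N b : ℚ) = r₂ ∨ (N b : ℚ) = r₃ at this
      rw [hb] at this
      tauto
    rw [he, card_empty, Nat.cast_zero, eq_comm] at h
    exact_mod_cast (mul_eq_zero.mp h).resolve_left hq.ne'
  have hmem : ∀ b, traceWord F D b ∈ traceCode F D := fun b => ⟨b, rfl⟩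
  refine ⟨?_, ?_, ⟨?_, ?_⟩, ?_⟩
  · have hset : {w : ℕ | w ≠ 0 ∧ weightCount (traceCode F D) w ≠ 0} = {N b₁, N b₂, N b₃} := by
      ext w
      simp only [Set.mem_ofPred_eq, Set.mem_insert_iff, Set.mem_singleton_iff]
      constructor
      · rintro ⟨w0, hw0⟩
        by_contra! hcon
        refine hw0 (hnone w (by exact_mod_cast w0) ?_ ?_ ?_)
        · rw [← hb₁]; exact_mod_cast hcon.1
        · rw [← hb₂]; exact_mod_cast hcon.2.1
        · rw [← hb₃]; exact_mod_cast hcon.2.2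
      · have key : ∀ (b : K) (r a : ℚ), (N b : ℚ) = r → r ≠ 0 → 0 < a →
            (weightCount (traceCode F D) (N b) : ℚ) = a →
            N b ≠ 0 ∧ weightCount (traceCode F D) (N b) ≠ 0 := by
          intro b r a h1 h2 h3 h4
          constructor
          · intro h
            rw [h, Nat.cast_zero] at h1
            exact h2 h1.symm
          · intro h
            rw [h, Nat.cast_zero] at h4
            exact h3.ne h4
        rintro (rfl | rfl | rfl)
        · exact key _ _ _ hb₁ h₁ ha₁ hv₁
        · exact key _ _ _ hb₂ h₂ ha₂ hv₂
        · exact key _ _ _ hb₃ h₃ ha₃ hv₃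
    rw [IsWeightCode, hset, Set.encard_insert_of_notMem, Set.encard_pair]
    · norm_num
    · intro h
      rw [h, hb₃] at hb₂
      exact h₂₃ hb₂.symm
    · simp only [Set.mem_insert_iff, Set.mem_singleton_iff, not_or]
      constructor
      · intro h
        rw [h, hb₂] at hb₁
        exact h₁₂ hb₁.symm
      · intro h
        rw [h, hb₃] at hb₁
        exact h₁₃ hb₁.symm
  · have hrk := LinearMap.finrank_range_add_finrank_ker (traceWord F D)
    have hk : Fintype.card (LinearMap.ker (traceWord F D)) = Fintype.card F := by
      rw [← hker, ← Fintype.card_subtype]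
      exact Fintype.card_congr (Equiv.refl _)
    rw [Module.card_eq_pow_finrank (K := F)] at hk
    have : Module.finrank F (LinearMap.ker (traceWord F D)) = 1 :=
      Nat.pow_right_injective (Fintype.one_lt_card (α := F)) (by simpa using hk)
    rw [traceCode]
    omega
  · intro r hr
    simp only [List.mem_cons, List.not_mem_nil, or_false] at hr
    rcases hr with rfl | rfl | rfl | rfl
    · refine ⟨0, Nat.cast_zero, hval 0 0 1 Nat.cast_zero ?_⟩
      rw [mul_one, ← hker]
      congr 2
      ext b
      simp [hN]
    · exact ⟨_, hb₁, hv₁⟩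
    · exact ⟨_, hb₂, hv₂⟩
    · exact ⟨_, hb₃, hv₃⟩
  · intro w h
    simp only [List.mem_cons, List.not_mem_nil, or_false, forall_eq_or_imp, forall_eq] at h
    exact hnone w h.1 h.2.1 h.2.2.1 h.2.2.2
  · intro r hr hr₁ hr₂ hr₃
    obtain ⟨b, hb⟩ : ∃ b : K, (N b : ℚ) = r := by
      rcases hr with rfl | rfl | rfl
      · exact ⟨b₁, hb₁⟩
      · exact ⟨b₂, hb₂⟩
      · exact ⟨b₃, hb₃⟩
    have hr0 : r ≠ 0 := by rcases hr with rfl | rfl | rfl <;> assumption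
    refine ⟨N b, hb, ⟨traceWord F D b, hmem b, 0, Submodule.zero_mem _, ?_, ?_⟩, ?_⟩
    · intro h
      rw [hN] at hb
      simp only [h, hammingNorm_zero, Nat.cast_zero] at hb
      exact hr0 hb.symm
    · rw [hammingDist_zero_right]
    · rintro d ⟨c, hc, c', hc', hne, rfl⟩
      -- By linearity, the distance of two words is the weight of their difference.
      rw [hammingDist_comm, hammingDist_eq_hammingNorm, neg_add_eq_sub]
      obtain ⟨x, hx⟩ : c - c' ∈ traceCode F D := Submodule.sub_mem _ hc hc'
      rw [← hx]
      have hx0 : (N x : ℚ) ≠ 0 := by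
        simp only [hN, hx, ne_eq, Nat.cast_eq_zero, hammingNorm_eq_zero, sub_eq_zero]
        exact hne
      have : (N b : ℚ) ≤ N x := by
        rw [hb]
        rcases hw x with h | h | h | h <;> change (N x : ℚ) = _ at h
        · exact absurd h hx0
        all_goals rw [h]; assumption
      exact_mod_cast this

end WeightPackage

/-! ### Sections of a quadric by the trace hyperplane -/

section TraceSections

open Finset QuadraticMap

variable {F K : Type*} [Field F] [Field K] [Algebra F K] {Q : QuadraticForm F K}

theorem polar_algebraMap (hone : ∀ x, polar Q x 1 = 2 * Algebra.trace F K x)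
    (x : K) (t : F) :
    polar Q x (algebraMap F K t) = 2 * t * Algebra.trace F K x := by
  rw [Algebra.algebraMap_eq_smul_one, polar_smul_right, hone, smul_eq_mul]
  ring

theorem trace_eq_zero_of_mem_radical (h2 : (2 : F) ≠ 0)
    (hone : ∀ x, polar Q x 1 = 2 * Algebra.trace F K x)
    {r : K} (hr : ∀ x, polar Q x r = 0) :
    Algebra.trace F K r = 0 := by
  have := hone r
  rw [polar_comm, hr, eq_comm] at this
  exact (mul_eq_zero.mp this).resolve_left h2

theorem quadraticForm_add_radical (h2 : (2 : F) ≠ 0)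
    {r : K} (hr : ∀ x, polar Q x r = 0) (x : K) :
    Q (x + r) = Q x := by
  have h0 : Q r = 0 := by
    have := hr r
    rw [polar_self, two_nsmul, ← two_mul] at this
    exact (mul_eq_zero.mp this).resolve_left h2
  have := hr x
  rw [polar, h0, sub_zero, sub_eq_zero] at this
  exact this

theorem quadraticForm_smul_one_add_smul (hone : ∀ x, polar Q x 1 = 2 * Algebra.trace F K x)
    (y : K) (t z : F) :
    Q (t • 1 + z • y) = Q 1 * t ^ 2 + 2 * t * z * Algebra.trace F K y + z ^ 2 * Q y := by
  have h : Q (t • 1 + z • y) = Q (t • 1) + Q (z • y) + polar Q (t • 1) (z • y) := by simp [polar]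
  rw [h, polar_smul_left, polar_smul_right, polar_comm, hone, QuadraticMap.map_smul,
    QuadraticMap.map_smul]
  simp only [smul_eq_mul]
  ring

variable [Fintype K]

theorem quadraticForm_one (h2 : (2 : F) ≠ 0) (hone : ∀ x, polar Q x 1 = 2 * Algebra.trace F K x)
    : Q 1 = (Module.finrank F K : F) := by
  have := hone 1
  rw [polar_self, two_nsmul, ← two_mul, ← map_one (algebraMap F K), Algebra.trace_algebraMap,
    map_one, nsmul_eq_mul, mul_one] at this
  exact mul_left_cancel₀ h2 this

/-- Double annihilator: a functional vanishing on the kernel of the polar map lies in the range of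
its transpose, and by reflexivity of K it is pairing with some y. This avoids assuming the form
nondegenerate. -/
theorem exists_trace_ne_zero_of_not_polar (b : K) :
    (∃ y, ∀ x, Algebra.trace F K (b * x) = polar Q x y) ∨
      ∃ r, (∀ x, polar Q x r = 0) ∧ Algebra.trace F K (b * r) ≠ 0 := by
  by_contra! hcon
  obtain ⟨h1, h2⟩ := hcon
  let B : K →ₗ[F] Module.Dual F K := Q.polarBilin
  let f : Module.Dual F K := Algebra.traceForm F K b
  have hf : f ∈ (LinearMap.ker B).dualAnnihilator := by
    rw [Submodule.mem_dualAnnihilator]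
    intro r hr
    refine h2 r fun x => ?_
    rw [polar_comm]
    have := LinearMap.congr_fun (LinearMap.mem_ker.mp hr) x
    simpa [B] using this
  rw [← LinearMap.range_dualMap_eq_dualAnnihilator_ker] at hf
  obtain ⟨Φ, hΦ⟩ := hf
  obtain ⟨y, rfl⟩ := (Module.evalEquiv F K).surjective Φ
  obtain ⟨x, hx⟩ := h1 y
  refine hx ?_
  have := LinearMap.congr_fun hΦ x
  simpa [B, f, polarBilin_apply_apply] using this.symm

/-- Splitting a count over `K` along the image of `A`. -/
theorem card_filter_eq_of_const_off_range [DecidableEq K] (A : K →ₗ[F] K) {N : K → ℚ} {w : ℚ}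
    (hN : ∀ b, b ∉ LinearMap.range A → N b = w) (r : ℚ) :
    (#{y | A y = 0} : ℚ) * #{b | N b = r}
      = (if w = r then ((#{y | A y = 0} : ℚ) - 1) * Fintype.card K else 0)
        + #{y | N (A y) = r} := by
  classical
  have h1 := card_filter_comp_linearMap A (fun b => N b = r)
  have h2 := card_filter_comp_linearMap A (fun _ => True)
  simp only [filter_true, card_univ, and_true] at h2
  rw [← card_filter_add_card_filter_not (s := {b | N b = r}) (fun b => b ∈ LinearMap.range A),
    filter_filter, filter_filter, h1]
  have e1 : univ.filter (fun b => N b = r ∧ b ∈ LinearMap.range A)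
      = {c | c ∈ LinearMap.range A ∧ N c = r}.toFinset := by
    ext b
    simp [and_comm]
  have e2 : univ.filter (fun b => N b = r ∧ b ∉ LinearMap.range A)
      = if w = r then {c | c ∈ LinearMap.range A}.toFinsetᶜ else ∅ := by
    ext b
    split_ifs with h
    · simp only [mem_filter, mem_univ, true_and, mem_compl, Set.mem_toFinset, Set.mem_ofPred_eq]
      exact ⟨fun h => h.2, fun hb => ⟨(hN b hb).trans h, hb⟩⟩
    · simp only [mem_filter, mem_univ, true_and, notMem_empty, iff_false, not_and, not_not]
      intro hb
      by_contra hb'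
      exact h ((hN b hb').symm.trans hb)
  have e3 : (#(if w = r then {c | c ∈ LinearMap.range A}.toFinsetᶜ else ∅) : ℚ)
      = if w = r then (Fintype.card K : ℚ) - Set.ncard {c | c ∈ LinearMap.range A} else 0 := by
    split_ifs
    · rw [card_compl, Nat.cast_sub (card_le_univ _), Set.ncard_eq_toFinset_card']
    · simp
  rw [e1, e2, Set.ncard_eq_toFinset_card']
  push_cast
  rw [e3, mul_add, add_comm]
  congr 1
  -- Thus |ker A| (|K| - |im A|) = (|ker A| - 1) |K|, the contribution from outside the image.
  have h2' : (Fintype.card K : ℚ) = #{y | A y = 0} * Set.ncard {c | c ∈ LinearMap.range A} := by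
    exact_mod_cast h2
  split_ifs
  · linear_combination h2'
  · simp

variable [Fintype F]

/-- The endomorphism representing the polar form through the trace form. -/
theorem exists_polar_eq_trace (Q : QuadraticForm F K) :
    ∃ A : K →ₗ[F] K, ∀ x y, Algebra.trace F K (A y * x) = polar Q x y := by
  have hnd := traceForm_nondegenerate F K
  refine ⟨((Algebra.traceForm F K).toDual hnd).symm.toLinearMap ∘ₗ Q.polarBilin, fun x y => ?_⟩
  have := LinearMap.BilinForm.apply_toDual_symm_apply (hB := hnd) (Q.polarBilin y) x
  rw [Algebra.traceForm_apply] at this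
  rw [LinearMap.comp_apply, LinearEquiv.coe_coe, this, polarBilin_apply_apply, polar_comm]

variable [DecidableEq F]

/-- Duality for the line t ↦ t·1. It meets the radical only in 0, because the trace is surjective
and 2 ≠ 0. -/
theorem card_trace_eq_zero (h2 : (2 : F) ≠ 0) (hQ : ∀ c, c ≠ 0 → #{x | Q x = c} = #{x | Q x = 1})
    (hone : ∀ x, polar Q x 1 = 2 * Algebra.trace F K x)
    (u : F) :
    (Fintype.card F : ℤ) ^ 2 * #{x | Q x = u ∧ Algebra.trace F K x = 0}
      = Fintype.card K + zeroExcess Q * Fintype.card F * (#{t | Q 1 * t ^ 2 = -u} - 1) := by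
  classical
  have hd := card_orthogonal_eq hQ (LinearMap.toSpanSingleton F K 1) u
  simp only [LinearMap.toSpanSingleton_apply, polar_smul_right, hone, smul_eq_mul] at hd
  have e1 : univ.filter (fun x => (∀ c : F, c * (2 * Algebra.trace F K x) = 0) ∧ Q x = u)
      = univ.filter fun x => Q x = u ∧ Algebra.trace F K x = 0 := by
    ext x
    simp only [mem_filter, mem_univ, true_and]
    constructor
    · rintro ⟨h, hu⟩
      have := h 1
      rw [one_mul] at this
      exact ⟨hu, (mul_eq_zero.mp this).resolve_left h2⟩
    · rintro ⟨hu, h⟩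
      exact ⟨fun c => by rw [h]; ring, hu⟩
  have e2 : univ.filter (fun c : F => ∀ x : K, c * (2 * Algebra.trace F K x) = 0) = {0} := by
    ext c
    simp only [mem_filter, mem_univ, true_and, mem_singleton]
    constructor
    · intro h
      obtain ⟨x, hx⟩ := Algebra.trace_surjective F K 1
      have := h x
      rw [hx, mul_one] at this
      exact (mul_eq_zero.mp this).resolve_right h2
    · rintro rfl x
      ring
  have e3 : univ.filter (fun c : F => Q (c • (1 : K)) = -u)
      = univ.filter fun t => Q 1 * t ^ 2 = -u := by
    ext c
    simp only [mem_filter, mem_univ, true_and, QuadraticMap.map_smul, smul_eq_mul]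
    rw [mul_comm, pow_two]
  rw [e1, e2, e3, card_singleton] at hd
  push_cast at hd
  linear_combination hd

/-- Duality for the map (t, z) ↦ t + z y. Excluding y from F + rad Q ensures that only (0, 0) maps
into the radical, so the first term of the duality is just |K|. -/
theorem card_trace_polar_eq_zero (h2 : (2 : F) ≠ 0)
    (hQ : ∀ c, c ≠ 0 → #{x | Q x = c} = #{x | Q x = 1})
    (hone : ∀ x, polar Q x 1 = 2 * Algebra.trace F K x)
    {y : K}
    (hy : ¬ ∃ t : F, ∀ x, polar Q x (y - algebraMap F K t) = 0) (u : F) :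
    (Fintype.card F : ℤ) ^ 3 * #{x | Q x = u ∧ Algebra.trace F K x = 0 ∧ polar Q x y = 0}
      = Fintype.card K + zeroExcess Q * (Fintype.card F * #{c : F × F | Q 1 * c.1 ^ 2
        + 2 * c.1 * c.2 * Algebra.trace F K y + c.2 ^ 2 * Q y = -u} - Fintype.card F ^ 2) := by
  classical
  have hd := card_orthogonal_eq hQ ((LinearMap.toSpanSingleton F K 1).coprod
    (LinearMap.toSpanSingleton F K y)) u
  simp only [LinearMap.coprod_apply, LinearMap.toSpanSingleton_apply, polar_add_right,
    polar_smul_right, hone, smul_eq_mul, quadraticForm_smul_one_add_smul hone, Prod.forall,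
    Fintype.card_prod] at hd
  have e1 : univ.filter (fun x => (∀ a b : F, a * (2 * Algebra.trace F K x) + b * polar Q x y = 0)
      ∧ Q x = u)
      = univ.filter fun x => Q x = u ∧ Algebra.trace F K x = 0 ∧ polar Q x y = 0 := by
    ext x
    simp only [mem_filter, mem_univ, true_and]
    constructor
    · rintro ⟨h, hu⟩
      have h01 := h 0 1
      have h10 := h 1 0
      rw [one_mul, zero_mul, zero_add] at h01
      rw [one_mul, zero_mul, add_zero] at h10
      exact ⟨hu, (mul_eq_zero.mp h10).resolve_left h2, h01⟩
    · rintro ⟨hu, h, h'⟩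
      exact ⟨fun a b => by rw [h, h']; ring, hu⟩
  have e2 : univ.filter (fun c : F × F => ∀ x : K, c.1 * (2 * Algebra.trace F K x)
      + c.2 * polar Q x y = 0) = {0} := by
    ext ⟨t, z⟩
    simp only [mem_filter, mem_univ, true_and, mem_singleton]
    constructor
    · intro h
      by_cases hz : z = 0
      · obtain ⟨x, hx⟩ := Algebra.trace_surjective F K 1
        have := h x
        rw [hx, mul_one, hz, zero_mul, add_zero] at this
        rw [hz, (mul_eq_zero.mp this).resolve_right h2]
        rfl
      · refine absurd ⟨-(t / z), fun x => ?_⟩ hy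
        rw [sub_eq_add_neg, polar_add_right, ← map_neg, neg_neg, polar_algebraMap hone]
        refine mul_left_cancel₀ hz ?_
        field_simp
        linear_combination h x
    · intro h x
      rw [Prod.mk_eq_zero] at h
      rw [h.1, h.2]
      ring
  rw [e1, e2, card_singleton] at hd
  push_cast at hd
  linear_combination hd

/-- If `b` is not represented by the polar form, `Tr (b x)` is equidistributed. -/
theorem card_trace_mul_eq_zero (h2 : (2 : F) ≠ 0)
    (hone : ∀ x, polar Q x 1 = 2 * Algebra.trace F K x)
    {b r : K} (hr : ∀ x, polar Q x r = 0)
    (hbr : Algebra.trace F K (b * r) ≠ 0) (u : F) :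
    Fintype.card F *
        #{x | Q x = u ∧ Algebra.trace F K x = 0 ∧ Algebra.trace F K (b * x) = 0}
      = #{x | Q x = u ∧ Algebra.trace F K x = 0} := by
  have htr := trace_eq_zero_of_mem_radical h2 hone hr
  rw [card_eq_sum_card_fiberwise (s := {x | Q x = u ∧ Algebra.trace F K x = 0})
    (f := fun x => Algebra.trace F K (b * x)) (t := univ) (fun _ _ => mem_univ _),
    ← card_univ, ← smul_eq_mul, ← sum_const]
  refine sum_congr rfl fun c _ => ?_
  -- Translation by d r preserves both Q and the trace, as r is in the radical, and raises Tr(bx) by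
  -- exactly c.
  set d := c / Algebra.trace F K (b * r) with hd
  have hrad : ∀ d : F, ∀ x, polar Q x (d • r) = 0 := fun d x => by
    rw [polar_smul_right, hr, smul_zero]
  have hdc : d * Algebra.trace F K (b * r) = c := by
    rw [hd]
    field_simp
  rw [filter_filter]
  refine card_bij' (fun x _ => x + d • r) (fun x _ => x + (-d) • r) ?_ ?_ ?_ ?_
  · intro x hx
    simp only [mem_filter, mem_univ, true_and] at hx ⊢
    refine ⟨⟨?_, ?_⟩, ?_⟩
    · rw [quadraticForm_add_radical h2 (hrad d), hx.1]
    · rw [map_add, map_smul, htr, hx.2.1, smul_zero, add_zero]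
    · rw [mul_add, mul_smul_comm, map_add, map_smul, hx.2.2, smul_eq_mul, hdc, zero_add]
  · intro x hx
    simp only [mem_filter, mem_univ, true_and] at hx ⊢
    refine ⟨?_, ?_, ?_⟩
    · rw [quadraticForm_add_radical h2 (hrad (-d)), hx.1.1]
    · rw [map_add, map_smul, htr, hx.1.2, smul_zero, add_zero]
    · rw [mul_add, mul_smul_comm, map_add, map_smul, hx.2, smul_eq_mul, neg_mul, hdc,
        add_neg_cancel]
  · intro x _
    rw [neg_smul, add_neg_cancel_right]
  · intro x _
    rw [neg_smul, neg_add_cancel_right]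

end TraceSections

/-! ### Weights of the words and sizes of the classes -/

section TraceSectionWeights

set_option linter.unusedSectionVars false

open Finset QuadraticMap

variable {F K : Type*} [Field F] [Field K] [Fintype F] [Fintype K] [Algebra F K]
  [DecidableEq F] [DecidableEq K]

/-- A quadratic form on `K` with equidistributed nonzero values, whose polar form is
`(x, y) ↦ Tr (A y * x)` and pairs `x` with `1` to `2 Tr x`. -/
structure IsTraceQuadric (Q : QuadraticForm F K) (A : K →ₗ[F] K) : Prop where
  two_ne : (2 : F) ≠ 0
  equi : ∀ c, c ≠ 0 → #{x | Q x = c} = #{x | Q x = 1}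
  polar_one : ∀ x, polar Q x 1 = 2 * Algebra.trace F K x
  trace_mul : ∀ x y, Algebra.trace F K (A y * x) = polar Q x y

/-- The nonzero `x` with `Q x = u` and `Tr x = 0`. -/
noncomputable def traceSection (Q : QuadraticForm F K) (u : F) : Finset K :=
  {x | x ≠ 0 ∧ Q x = u ∧ Algebra.trace F K x = 0}

theorem card_traceSection (Q : QuadraticForm F K) (u : F) :
    (#(traceSection Q u) : ℤ)
      = #{x | Q x = u ∧ Algebra.trace F K x = 0} - if u = 0 then 1 else 0 := by
  split_ifs with hu
  · have h0 : (0 : K) ∈ univ.filter (fun x => Q x = u ∧ Algebra.trace F K x = 0) := by simp [hu]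
    have : traceSection Q u
        = (univ.filter fun x => Q x = u ∧ Algebra.trace F K x = 0).erase 0 := by
      ext x
      simp [traceSection]
    rw [this, card_erase_of_mem h0, Nat.cast_sub (card_pos.mpr ⟨0, h0⟩)]
    simp
  · rw [sub_zero, traceSection]
    congr 2
    ext x
    simp only [mem_filter, mem_univ, true_and, and_iff_right_iff_imp]
    rintro ⟨h, -⟩ rfl
    exact hu (by rw [← h, QuadraticMap.map_zero])

/-- The point 0 is removed from the defining set but may be kept in these counts: Tr(b·0) = 0, so it
cancels. -/
theorem hammingNorm_traceWord_add (Q : QuadraticForm F K) (u : F) (b : K) :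
    hammingNorm (traceWord F (traceSection Q u) b)
      + #{x | Q x = u ∧ Algebra.trace F K x = 0 ∧ Algebra.trace F K (b * x) = 0}
      = #{x | Q x = u ∧ Algebra.trace F K x = 0} := by
  have h1 : hammingNorm (traceWord F (traceSection Q u) b)
      = #{x | (Q x = u ∧ Algebra.trace F K x = 0) ∧ ¬ Algebra.trace F K (b * x) = 0} := by
    rw [hammingNorm]
    refine card_bij (fun x _ => (x : K)) ?_ ?_ ?_
    · rintro ⟨x, hx⟩ h
      have h' := (mem_filter.mp h).2
      simp only [mem_filter, mem_univ, true_and, traceSection] at hx ⊢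
      exact ⟨hx.2, h'⟩
    · rintro x _ y _ h
      exact Subtype.ext h
    · intro x hx
      simp only [mem_filter, mem_univ, true_and] at hx
      have hx0 : x ≠ 0 := by
        rintro rfl
        simp at hx
      refine ⟨⟨x, ?_⟩, ?_, rfl⟩
      · simp only [traceSection, mem_filter, mem_univ, true_and]
        exact ⟨hx0, hx.1⟩
      · simp only [mem_filter, mem_univ, true_and]
        exact hx.2
  rw [h1, ← card_filter_add_card_filter_not (s := {x | Q x = u ∧ Algebra.trace F K x = 0})
    (fun x => Algebra.trace F K (b * x) = 0), filter_filter, filter_filter, add_comm]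
  simp only [and_assoc]

theorem hammingNorm_traceWord_of_mem (Q : QuadraticForm F K) (u : F) {b : K}
    (hb : ∃ c, algebraMap F K c = b) :
    hammingNorm (traceWord F (traceSection Q u) b) = 0 := by
  obtain ⟨c, hc⟩ := hb
  rw [hammingNorm_eq_zero]
  ext x
  have hx := x.2
  simp only [traceSection, mem_filter, mem_univ, true_and] at hx
  change Algebra.trace F K (b * x) = 0
  rw [← hc, ← Algebra.smul_def, map_smul, hx.2.2, smul_zero]

theorem card_filter_trace_eq_zero (F K : Type*) [Field F] [Field K] [Fintype F] [Fintype K]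
    [Algebra F K] [DecidableEq F] :
    (Fintype.card F : ℤ) * #{x : K | Algebra.trace F K x = 0} = Fintype.card K := by
  have := card_filter_comp_linearMap (Algebra.trace F K) (fun _ => True)
  simp only [filter_true, card_univ, and_true] at this
  have hr : {c | c ∈ LinearMap.range (Algebra.trace F K)} = Set.univ := by
    ext c
    simpa using Algebra.trace_surjective F K c
  rw [hr, Set.ncard_univ, Nat.card_eq_fintype_card] at this
  rw [this]
  push_cast
  ring

namespace IsTraceQuadric

variable {Q : QuadraticForm F K} {A : K →ₗ[F] K}

theorem apply_eq_zero_iff (h : IsTraceQuadric Q A) (y : K) : A y = 0 ↔ ∀ x, polar Q x y = 0 := by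
  simp_rw [← h.trace_mul]
  constructor
  · intro hy x
    rw [hy, zero_mul, map_zero]
  · intro hy
    exact trace_mul_eq_zero (F := F) fun x => by rw [mul_comm]; exact hy x

theorem apply_algebraMap (h : IsTraceQuadric Q A) (t : F) :
    A (algebraMap F K t) = algebraMap F K (2 * t) := by
  rw [← sub_eq_zero]
  refine trace_mul_eq_zero (F := F) fun x => ?_
  rw [mul_comm, sub_mul, map_sub, h.trace_mul, polar_algebraMap h.polar_one, ← Algebra.smul_def,
    map_smul, smul_eq_mul, sub_self]

/-- On F the map A is multiplication by 2, so the preimage of F under A is F + rad Q. These are the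
y for which A(y) gives the zero word. -/
theorem apply_mem_range_iff (h : IsTraceQuadric Q A) (y : K) :
    (∃ c, algebraMap F K c = A y) ↔ ∃ t : F, ∀ x, polar Q x (y - algebraMap F K t) = 0 := by
  simp_rw [← h.apply_eq_zero_iff, map_sub, h.apply_algebraMap, sub_eq_zero]
  constructor
  · rintro ⟨c, hc⟩
    refine ⟨c / 2, ?_⟩
    rw [mul_div_cancel₀ _ h.two_ne, hc]
  · rintro ⟨t, ht⟩
    exact ⟨2 * t, ht.symm⟩

theorem card_apply_mem_range (h : IsTraceQuadric Q A) :
    #{y | ∃ c, algebraMap F K c = A y} = #{y | A y = 0} * Fintype.card F := by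
  classical
  rw [card_filter_comp_linearMap A (fun b => ∃ c, algebraMap F K c = b)]
  congr 1
  have : {b | b ∈ LinearMap.range A ∧ ∃ c, algebraMap F K c = b} = Set.range (algebraMap F K) := by
    ext b
    constructor
    · rintro ⟨-, h⟩
      exact h
    · rintro ⟨c, rfl⟩
      refine ⟨⟨algebraMap F K (c / 2), ?_⟩, c, rfl⟩
      rw [h.apply_algebraMap, mul_div_cancel₀ _ h.two_ne]
  rw [this, ← Set.image_univ, Set.ncard_image_of_injective _ (algebraMap F K).injective,
    Set.ncard_univ, Nat.card_eq_fintype_card]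

/-- Such a y is t plus a radical vector, which changes neither trace nor form. Hence all these y
fall into a single class of the later classifications. -/
theorem values_of_apply_mem_range (h : IsTraceQuadric Q A) {y : K}
    (hy : ∃ c, algebraMap F K c = A y) :
    ∃ t, Algebra.trace F K y = Q 1 * t ∧ Q y = Q 1 * t ^ 2 := by
  obtain ⟨t, ht⟩ := (h.apply_mem_range_iff y).mp hy
  refine ⟨t, ?_, ?_⟩
  · have := trace_eq_zero_of_mem_radical h.two_ne h.polar_one ht
    rw [map_sub, sub_eq_zero, Algebra.trace_algebraMap, nsmul_eq_mul,
      ← quadraticForm_one h.two_ne h.polar_one] at this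
    exact this
  · have := quadraticForm_add_radical h.two_ne ht (algebraMap F K t)
    rw [add_sub_cancel, Algebra.algebraMap_eq_smul_one, QuadraticMap.map_smul, smul_eq_mul] at this
    rw [this]
    ring

/-- Some radical vector r has Tr(br) ≠ 0, so Tr(bx) vanishes on exactly one q-th of the points with
Q = u and trace 0. -/
theorem weight_off_range (h : IsTraceQuadric Q A) (u : F) {b : K} (hb : b ∉ LinearMap.range A) :
    (Fintype.card F : ℤ) ^ 3 * hammingNorm (traceWord F (traceSection Q u) b)
      = (Fintype.card F - 1) * (Fintype.card K
        + zeroExcess Q * Fintype.card F * (#{t | Q 1 * t ^ 2 = -u} - 1)) := by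
  rcases exists_trace_ne_zero_of_not_polar (Q := Q) b with ⟨y, hy⟩ | ⟨r, hr, hbr⟩
  · refine absurd ⟨y, ?_⟩ hb
    rw [← sub_eq_zero]
    refine trace_mul_eq_zero (F := F) fun x => ?_
    rw [mul_comm, sub_mul, map_sub, h.trace_mul, hy, sub_self]
  · have h1 := hammingNorm_traceWord_add Q u b
    have h3 := card_trace_mul_eq_zero h.two_ne h.polar_one hr hbr u
    have h4 := card_trace_eq_zero h.two_ne h.equi h.polar_one u
    rw [← h4]
    zify at h1 h3
    linear_combination (Fintype.card F : ℤ) ^ 3 * h1 - (Fintype.card F : ℤ) ^ 2 * h3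

/-- The weight is the difference of two dual counts, one for the line of 1 and one for the plane of
1 and y. -/
theorem weight_apply (h : IsTraceQuadric Q A) (u : F) {y : K}
    (hy : ¬ ∃ c, algebraMap F K c = A y) :
    (Fintype.card F : ℤ) ^ 3 * hammingNorm (traceWord F (traceSection Q u) (A y))
      = (Fintype.card F - 1) * Fintype.card K
        + zeroExcess Q * Fintype.card F * (Fintype.card F * #{t | Q 1 * t ^ 2 = -u}
          - #{c : F × F | Q 1 * c.1 ^ 2 + 2 * c.1 * c.2 * Algebra.trace F K y + c.2 ^ 2 * Q y
              = -u}) := by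
  rw [h.apply_mem_range_iff] at hy
  have h1 := hammingNorm_traceWord_add Q u (A y)
  simp_rw [h.trace_mul] at h1
  have h3 := card_trace_polar_eq_zero h.two_ne h.equi h.polar_one hy u
  have h4 := card_trace_eq_zero h.two_ne h.equi h.polar_one u
  zify at h1
  linear_combination (Fintype.card F : ℤ) ^ 3 * h1 - h3 + (Fintype.card F : ℤ) * h4

theorem ringChar_ne_two (h : IsTraceQuadric Q A) : ringChar F ≠ 2 := by
  intro hF
  apply h.two_ne
  have := ringChar.Nat.cast_ringChar (R := F)
  rw [hF] at this
  exact_mod_cast this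

/-- The distribution of the discriminant `Tr(y)² - Q(1) Q(y)`. -/
theorem card_disc_eq (h : IsTraceQuadric Q A) (h1 : Q 1 ≠ 0) (d : F) :
    (Fintype.card F : ℤ) * #{y | Algebra.trace F K y ^ 2 - Q 1 * Q y = d}
      = Fintype.card K + zeroExcess Q * Fintype.card F * quadraticChar F d := by
  have htr : ∀ t : F, Algebra.trace F K (algebraMap F K t) = Q 1 * t := by
    intro t
    rw [Algebra.trace_algebraMap, nsmul_eq_mul, ← quadraticForm_one h.two_ne h.polar_one]
  have hQ : ∀ (y : K) (t : F), Q (y + algebraMap F K t)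
      = Q y + 2 * t * Algebra.trace F K y + Q 1 * t ^ 2 := by
    intro y t
    have := quadraticForm_smul_one_add_smul h.polar_one y t 1
    rw [one_smul, ← Algebra.algebraMap_eq_smul_one, add_comm] at this
    rw [this]
    ring
  -- Since Q(1) ≠ 0, K is the orthogonal sum of F·1 and the trace-zero hyperplane. The discriminant
  -- ignores the F·1 part and equals -Q(1) Q(x) on the trace-zero part x.
  have hb : #{y | Algebra.trace F K y ^ 2 - Q 1 * Q y = d}
      = #((univ : Finset F) ×ˢ
        (univ.filter fun x : K => Q x = -d / Q 1 ∧ Algebra.trace F K x = 0)) := by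
    refine card_bij' (fun y _ => (Algebra.trace F K y / Q 1,
      y + algebraMap F K (-(Algebra.trace F K y / Q 1)))) (fun c _ => c.2 + algebraMap F K c.1)
      ?_ ?_ ?_ ?_
    · intro y hy
      simp only [mem_filter, mem_univ, true_and, mem_product] at hy ⊢
      constructor
      · rw [hQ, eq_div_iff h1, ← hy]
        field_simp
        ring
      · rw [map_add, htr]
        field_simp
        ring
    · rintro ⟨t, x⟩ hx
      simp only [mem_filter, mem_univ, true_and, mem_product] at hx ⊢
      rw [hQ, map_add, htr, hx.1, hx.2]
      field_simp
      ring
    · intro y _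
      simp
    · rintro ⟨t, x⟩ hx
      simp only [mem_filter, mem_univ, true_and, mem_product] at hx ⊢
      rw [map_add, htr, hx.2, zero_add, mul_div_cancel_left₀ _ h1, map_neg, add_neg_cancel_right]
  have h4 := card_trace_eq_zero h.two_ne h.equi h.polar_one (-d / Q 1)
  rw [card_filter_mul_sq_eq h.ringChar_ne_two h1,
    (by field_simp : Q 1 * -(-d / Q 1) = d)] at h4
  rw [hb, card_product, card_univ]
  push_cast
  linear_combination h4

theorem card_quadraticChar_disc_eq (h : IsTraceQuadric Q A) (h1 : Q 1 ≠ 0) {i : ℤ}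
    (hi : i = 1 ∨ i = -1) :
    2 * (Fintype.card F : ℤ) * #{y | quadraticChar F (Algebra.trace F K y ^ 2 - Q 1 * Q y) = i}
      = (Fintype.card F - 1) * (Fintype.card K + zeroExcess Q * Fintype.card F * i) := by
  have hs : #{y | quadraticChar F (Algebra.trace F K y ^ 2 - Q 1 * Q y) = i}
      = ∑ d with quadraticChar F (1 * d) = i, #{y | Algebra.trace F K y ^ 2 - Q 1 * Q y = d} := by
    rw [card_eq_sum_card_fiberwise (f := fun y => Algebra.trace F K y ^ 2 - Q 1 * Q y)
      (t := univ.filter fun d => quadraticChar F (1 * d) = i)]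
    · refine sum_congr rfl fun d hd => ?_
      rw [filter_filter]
      congr 1
      ext y
      simp only [mem_filter, mem_univ, true_and, one_mul] at hd ⊢
      constructor
      · exact fun h => h.2
      · rintro rfl
        exact ⟨hd, rfl⟩
    · intro y hy
      simpa using hy
  rw [hs, ← two_mul_card_quadraticChar_eq h.ringChar_ne_two one_ne_zero hi, mul_assoc,
    Nat.cast_sum, mul_sum, mul_assoc]
  congr 1
  rw [← nsmul_eq_mul, ← sum_const]
  refine sum_congr rfl fun d hd => ?_
  simp only [mem_filter, mem_univ, true_and, one_mul] at hd
  rw [h.card_disc_eq h1, hd]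

theorem card_trace_eq_zero_of_isotropic (h : IsTraceQuadric Q A) (h1 : Q 1 = 0) (u : F) :
    (Fintype.card F : ℤ) ^ 2 * #{x | Q x = u ∧ Algebra.trace F K x = 0}
      = Fintype.card K + zeroExcess Q * Fintype.card F
        * ((if u = 0 then (Fintype.card F : ℤ) else 0) - 1) := by
  rw [card_trace_eq_zero h.two_ne h.equi h.polar_one, h1]
  congr 3
  by_cases hu : u = 0
  · simp [hu]
  · have : ¬ 0 = -u := fun h => hu (by rw [← neg_neg u, ← h, neg_zero])
    simp [hu, this]

/-- Half of the nonzero values d satisfy χ(ad) = 1, and each is taken equally often on the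
trace-zero hyperplane. -/
theorem card_quadraticChar_of_isotropic (h : IsTraceQuadric Q A) (h1 : Q 1 = 0) {a : F}
    (ha : a ≠ 0) :
    2 * (Fintype.card F : ℤ) ^ 2
        * #{y | Algebra.trace F K y = 0 ∧ quadraticChar F (a * Q y) = 1}
      = (Fintype.card F - 1) * (Fintype.card K - zeroExcess Q * Fintype.card F) := by
  have hs : #{y | Algebra.trace F K y = 0 ∧ quadraticChar F (a * Q y) = 1}
      = ∑ d with quadraticChar F (a * d) = 1, #{y | Q y = d ∧ Algebra.trace F K y = 0} := by
    rw [card_eq_sum_card_fiberwise (f := fun y => Q y)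
      (t := univ.filter fun d => quadraticChar F (a * d) = 1)]
    · refine sum_congr rfl fun d hd => ?_
      rw [filter_filter]
      congr 1
      ext y
      simp only [mem_filter, mem_univ, true_and] at hd ⊢
      constructor
      · exact fun h => ⟨h.2, h.1.1⟩
      · rintro ⟨rfl, h⟩
        exact ⟨⟨h, hd⟩, rfl⟩
    · intro y hy
      simp only [coe_filter, mem_univ, true_and, Set.mem_ofPred_eq] at hy ⊢
      exact hy.2
  rw [hs, ← two_mul_card_quadraticChar_eq h.ringChar_ne_two ha (Or.inl rfl), mul_assoc,
    Nat.cast_sum, mul_sum, mul_assoc]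
  congr 1
  rw [← nsmul_eq_mul, ← sum_const]
  refine sum_congr rfl fun d hd => ?_
  simp only [mem_filter, mem_univ, true_and] at hd
  have hd0 : d ≠ 0 := by
    rintro rfl
    simp at hd
  rw [h.card_trace_eq_zero_of_isotropic h1, if_neg hd0]
  ring

end IsTraceQuadric

end TraceSectionWeights

/-! ### Codes governed by three classes of y -/

section ThreeWeights

open Finset QuadraticMap

variable {F K : Type*} [Field F] [Field K] [Fintype F] [Fintype K] [Algebra F K]
  [DecidableEq F] [DecidableEq K]

namespace IsTraceQuadric

variable {Q : QuadraticForm F K} {A : K →ₗ[F] K}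

/-- The parameters of the code of `traceSection Q u`, when the weights of the words `A y` are
governed by three classes of elements `y` and all other words have the same weight `w`. -/
theorem traceCode_of_classes (h : IsTraceQuadric Q A) (u : F) {r₁ r₂ r₃ a₁ a₂ a₃ w R : ℚ}
    (P₁ P₂ P₃ : K → Prop) [DecidablePred P₁] [DecidablePred P₂] [DecidablePred P₃]
    (hR : (#{y | A y = 0} : ℚ) = R)
    (h₁₂ : r₁ ≠ r₂) (h₁₃ : r₁ ≠ r₃) (h₂₃ : r₂ ≠ r₃) (h₁ : r₁ ≠ 0) (h₂ : r₂ ≠ 0) (h₃ : r₃ ≠ 0)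
    (ha₁ : 0 < a₁) (ha₂ : 0 < a₂) (ha₃ : 0 < a₃)
    (hw : w = r₁ ∨ w = r₂ ∨ w = r₃)
    (hout : ∀ b, b ∉ LinearMap.range A →
      (hammingNorm (traceWord F (traceSection Q u) b) : ℚ) = w)
    (hP : ∀ y, P₁ y ∨ P₂ y ∨ P₃ y)
    (hd₁ : ∀ y, (∃ c, algebraMap F K c = A y) → P₁ y ∧ ¬ P₂ y ∧ ¬ P₃ y)
    (hw₁ : ∀ y, (¬ ∃ c, algebraMap F K c = A y) → P₁ y →
      (hammingNorm (traceWord F (traceSection Q u) (A y)) : ℚ) = r₁)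
    (hw₂ : ∀ y, (¬ ∃ c, algebraMap F K c = A y) → P₂ y →
      (hammingNorm (traceWord F (traceSection Q u) (A y)) : ℚ) = r₂)
    (hw₃ : ∀ y, (¬ ∃ c, algebraMap F K c = A y) → P₃ y →
      (hammingNorm (traceWord F (traceSection Q u) (A y)) : ℚ) = r₃)
    (hn₁ : Fintype.card F * R * a₁
      = (if w = r₁ then (R - 1) * Fintype.card K else 0) + (#{y | P₁ y} - R * Fintype.card F))
    (hn₂ : Fintype.card F * R * a₂
      = (if w = r₂ then (R - 1) * Fintype.card K else 0) + #{y | P₂ y})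
    (hn₃ : Fintype.card F * R * a₃
      = (if w = r₃ then (R - 1) * Fintype.card K else 0) + #{y | P₃ y})
    (hsum : (Fintype.card F : ℚ) * (1 + a₁ + a₂ + a₃) = Fintype.card K) :
    IsWeightCode 3 (traceCode F (traceSection Q u)) ∧
    Module.finrank F (traceCode F (traceSection Q u)) = Module.finrank F K - 1 ∧
    HasWeightDistribution (traceCode F (traceSection Q u))
      [(0, 1), (r₁, a₁), (r₂, a₂), (r₃, a₃)] ∧
    ∀ r, (r = r₁ ∨ r = r₂ ∨ r = r₃) → r ≤ r₁ → r ≤ r₂ → r ≤ r₃ →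
      ∃ d : ℕ, (d : ℚ) = r ∧ HasMinDistance (traceCode F (traceSection Q u)) d := by
  classical
  set N : K → ℚ := fun b => (hammingNorm (traceWord F (traceSection Q u) b) : ℚ) with hN
  have hR0 : R ≠ 0 := by
    rw [← hR]
    have : 0 < #{y | A y = 0} := card_pos.mpr ⟨0, by simp⟩
    positivity
  have hzero : ∀ y, (∃ c, algebraMap F K c = A y) → N (A y) = 0 := by
    intro y hy
    simp only [hN, hammingNorm_traceWord_of_mem Q u hy, Nat.cast_zero]
  have hcl : ∀ y, (∃ c, algebraMap F K c = A y) ∨ P₁ y ∧ N (A y) = r₁ ∨ P₂ y ∧ N (A y) = r₂ ∨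
      P₃ y ∧ N (A y) = r₃ := by
    intro y
    by_cases hy : ∃ c, algebraMap F K c = A y
    · exact Or.inl hy
    · rcases hP y with h | h | h
      · exact Or.inr (Or.inl ⟨h, hw₁ y hy h⟩)
      · exact Or.inr (Or.inr (Or.inl ⟨h, hw₂ y hy h⟩))
      · exact Or.inr (Or.inr (Or.inr ⟨h, hw₃ y hy h⟩))
  -- The first class also contains the R q elements y with A(y) in F; their words are zero and must
  -- be removed.
  have s₁ : (#{y | N (A y) = r₁} : ℚ) = #{y | P₁ y} - R * Fintype.card F := by
    have hdeg := h.card_apply_mem_range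
    rw [eq_sub_iff_add_eq, ← hR]
    norm_cast
    rw [← hdeg, ← card_union_of_disjoint]
    · congr 1
      ext y
      simp only [mem_union, mem_filter, mem_univ, true_and]
      constructor
      · rintro (hy | hy)
        · rcases hcl y with g | g | g | g
          · exact (hd₁ y g).1
          · exact g.1
          · exact absurd (hy.symm.trans g.2) h₁₂
          · exact absurd (hy.symm.trans g.2) h₁₃
        · exact (hd₁ y hy).1
      · intro hy
        by_cases g : ∃ c, algebraMap F K c = A y
        · exact Or.inr g
        · exact Or.inl (hw₁ y g hy)
    · rw [disjoint_filter]
      intro y _ hy g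
      rw [hzero y g] at hy
      exact h₁ hy.symm
  have s₂ : (#{y | N (A y) = r₂} : ℚ) = #{y | P₂ y} := by
    congr 2
    ext y
    simp only [mem_filter, mem_univ, true_and]
    constructor
    · intro hy
      rcases hcl y with g | g | g | g
      · exact absurd (hy.symm.trans (hzero y g)) h₂
      · exact absurd (g.2.symm.trans hy) h₁₂
      · exact g.1
      · exact absurd (hy.symm.trans g.2) h₂₃
    · intro hy
      exact hw₂ y (fun g => (hd₁ y g).2.1 hy) hy
  have s₃ : (#{y | N (A y) = r₃} : ℚ) = #{y | P₃ y} := by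
    congr 2
    ext y
    simp only [mem_filter, mem_univ, true_and]
    constructor
    · intro hy
      rcases hcl y with g | g | g | g
      · exact absurd (hy.symm.trans (hzero y g)) h₃
      · exact absurd (g.2.symm.trans hy) h₁₃
      · exact absurd (g.2.symm.trans hy) h₂₃
      · exact g.1
    · intro hy
      exact hw₃ y (fun g => (hd₁ y g).2.2 hy) hy
  have c₁ := card_filter_eq_of_const_off_range A hout r₁
  have c₂ := card_filter_eq_of_const_off_range A hout r₂
  have c₃ := card_filter_eq_of_const_off_range A hout r₃
  rw [hR] at c₁ c₂ c₃
  refine traceCode_of_three_weights _ h₁₂ h₁₃ h₂₃ h₁ h₂ h₃ ha₁ ha₂ ha₃ ?_ ?_ ?_ ?_ hsum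
  · intro b
    by_cases hb : b ∈ LinearMap.range A
    · obtain ⟨y, rfl⟩ := hb
      rcases hcl y with g | g | g | g
      · exact Or.inl (hzero y g)
      · exact Or.inr (Or.inl g.2)
      · exact Or.inr (Or.inr (Or.inl g.2))
      · exact Or.inr (Or.inr (Or.inr g.2))
    · rw [hout b hb]
      exact Or.inr hw
  -- Class sizes count y, and each b in the image of A comes from R of them, so the comparison is
  -- made after multiplying by R.
  · refine mul_left_cancel₀ hR0 ?_
    rw [c₁]
    linear_combination s₁ - hn₁
  · refine mul_left_cancel₀ hR0 ?_
    rw [c₂]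
    linear_combination s₂ - hn₂
  · refine mul_left_cancel₀ hR0 ?_
    rw [c₃]
    linear_combination s₃ - hn₃

end IsTraceQuadric

end ThreeWeights

/-! ### Numerical form of the counts; the case u = 0, Q(1) ≠ 0 -/

section FourCases

open Finset QuadraticMap

variable {F K : Type*} [Field F] [Field K] [Fintype F] [Fintype K] [Algebra F K]
  [DecidableEq F] [DecidableEq K]

theorem separated_weights {p r g : ℚ} (hp : 0 < p) (hg : 0 < g) (hr : g < r) :
    p * r ≠ p * (r + g) ∧ p * r ≠ p * (r - g) ∧ p * (r + g) ≠ p * (r - g) ∧ p * r ≠ 0 ∧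
    p * (r + g) ≠ 0 ∧ p * (r - g) ≠ 0 ∧ p * (r - g) ≤ p * r ∧ p * (r - g) ≤ p * (r + g) := by
  have h1 : 0 < p * g := mul_pos hp hg
  have h2 : 0 < p * (r - g) := mul_pos hp (by linarith)
  refine ⟨?_, ?_, ?_, ?_, ?_, ?_, ?_, ?_⟩
  · exact ne_of_lt (by linarith)
  · exact ne_of_gt (by linarith)
  · exact ne_of_gt (by linarith)
  · exact ne_of_gt (by linarith)
  · exact ne_of_gt (by linarith)
  · exact ne_of_gt (by linarith)
  · linarith
  · linarith

theorem frequency_pos {q x y : ℚ} (hq : 3 ≤ q) (hx : 1 ≤ x) (hy : 1 ≤ y) :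
    0 < y ^ 2 * x ^ 2 * q ^ 3 - (q - 1) * (x ^ 2 * q ^ 2) - 1 := by
  have e1 : 1 * (x ^ 2 * q ^ 3) ≤ y ^ 2 * (x ^ 2 * q ^ 3) :=
    mul_le_mul_of_nonneg_right (one_le_pow₀ hy) (by positivity)
  have e2 : 1 < (x * q) ^ 2 := one_lt_pow₀ (by nlinarith) two_ne_zero
  linarith

namespace IsTraceQuadric

variable {Q : QuadraticForm F K} {A : K →ₗ[F] K} {q x y : ℚ}

theorem disc_eq_zero_of_apply_mem_range (h : IsTraceQuadric Q A) {z : K}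
    (hz : ∃ c, algebraMap F K c = A z) : Algebra.trace F K z ^ 2 - Q 1 * Q z = 0 := by
  obtain ⟨t, h1, h2⟩ := h.values_of_apply_mem_range hz
  rw [h1, h2]
  ring

/-- The parameters are y = q^ε and x = q^(ℓ-ε-2) in the application. They make |K|, the radical
order y² and the exponential sum polynomials in q, x, y, with no truncated exponents. -/
theorem card_traceSection_eq (h : IsTraceQuadric Q A) (u : F) (hF : (Fintype.card F : ℚ) = q)
    (hq : 3 ≤ q) (hK : (Fintype.card K : ℚ) = y ^ 2 * x ^ 2 * q ^ 4)
    (hS : (zeroExcess Q : ℚ) = -(y ^ 2 * x * q ^ 2)) :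
    (#(traceSection Q u) : ℚ) = y ^ 2 * x ^ 2 * q ^ 2
      - y ^ 2 * x * q * (#{t | Q 1 * t ^ 2 = -u} - 1) - if u = 0 then 1 else 0 := by
  have h1 : (#(traceSection Q u) : ℚ)
      = #{x | Q x = u ∧ Algebra.trace F K x = 0} - if u = 0 then 1 else 0 := by
    exact_mod_cast card_traceSection Q u
  have h2 : (Fintype.card F : ℚ) ^ 2 * #{x | Q x = u ∧ Algebra.trace F K x = 0}
      = Fintype.card K + zeroExcess Q * Fintype.card F * (#{t | Q 1 * t ^ 2 = -u} - 1) := by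
    exact_mod_cast card_trace_eq_zero h.two_ne h.equi h.polar_one u
  rw [hF, hK, hS] at h2
  rw [h1]
  have hq0 : q ^ 2 ≠ 0 := by positivity
  refine mul_left_cancel₀ hq0 ?_
  linear_combination h2

theorem weight_off_range_eq (h : IsTraceQuadric Q A) (u : F) (hF : (Fintype.card F : ℚ) = q)
    (hq : 3 ≤ q) (hK : (Fintype.card K : ℚ) = y ^ 2 * x ^ 2 * q ^ 4)
    (hS : (zeroExcess Q : ℚ) = -(y ^ 2 * x * q ^ 2)) {M : ℚ}
    (hM : (#{t | Q 1 * t ^ 2 = -u} : ℚ) = M) (b : K) (hb : b ∉ LinearMap.range A) :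
    (hammingNorm (traceWord F (traceSection Q u) b) : ℚ)
      = (q - 1) * (y ^ 2 * x ^ 2 * q - y ^ 2 * x * (M - 1)) := by
  have h1 : (Fintype.card F : ℚ) ^ 3 * hammingNorm (traceWord F (traceSection Q u) b)
      = (Fintype.card F - 1) * (Fintype.card K
        + zeroExcess Q * Fintype.card F * (#{t | Q 1 * t ^ 2 = -u} - 1)) := by
    exact_mod_cast h.weight_off_range u hb
  rw [hF, hK, hS, hM] at h1
  have hq0 : q ^ 3 ≠ 0 := by positivity
  refine mul_left_cancel₀ hq0 ?_
  linear_combination h1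

theorem weight_apply_eq (h : IsTraceQuadric Q A) (u : F) (hF : (Fintype.card F : ℚ) = q)
    (hq : 3 ≤ q) (hK : (Fintype.card K : ℚ) = y ^ 2 * x ^ 2 * q ^ 4)
    (hS : (zeroExcess Q : ℚ) = -(y ^ 2 * x * q ^ 2)) {M M₂ : ℚ}
    (hM : (#{t | Q 1 * t ^ 2 = -u} : ℚ) = M) (z : K) (hz : ¬ ∃ c, algebraMap F K c = A z)
    (hM₂ : (#{c : F × F | Q 1 * c.1 ^ 2 + 2 * c.1 * c.2 * Algebra.trace F K z + c.2 ^ 2 * Q z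
      = -u} : ℚ) = M₂) :
    (hammingNorm (traceWord F (traceSection Q u) (A z)) : ℚ)
      = (q - 1) * (y ^ 2 * x ^ 2 * q) - y ^ 2 * x * (q * M - M₂) := by
  have h1 : (Fintype.card F : ℚ) ^ 3 * hammingNorm (traceWord F (traceSection Q u) (A z))
      = (Fintype.card F - 1) * Fintype.card K
        + zeroExcess Q * Fintype.card F * (Fintype.card F * #{t | Q 1 * t ^ 2 = -u}
          - #{c : F × F | Q 1 * c.1 ^ 2 + 2 * c.1 * c.2 * Algebra.trace F K z + c.2 ^ 2 * Q z
              = -u}) := by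
    exact_mod_cast h.weight_apply u hz
  rw [hF, hK, hS, hM, hM₂] at h1
  have hq0 : q ^ 3 ≠ 0 := by positivity
  refine mul_left_cancel₀ hq0 ?_
  linear_combination h1

theorem card_disc_classes (h : IsTraceQuadric Q A) (h1 : Q 1 ≠ 0)
    (hF : (Fintype.card F : ℚ) = q)
    (hq : 3 ≤ q) (hK : (Fintype.card K : ℚ) = y ^ 2 * x ^ 2 * q ^ 4)
    (hS : (zeroExcess Q : ℚ) = -(y ^ 2 * x * q ^ 2)) :
    (#{z | Algebra.trace F K z ^ 2 - Q 1 * Q z = 0} : ℚ) = y ^ 2 * x ^ 2 * q ^ 3 ∧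
    (#{z | quadraticChar F (Algebra.trace F K z ^ 2 - Q 1 * Q z) = 1} : ℚ)
      = (q - 1) / 2 * (y ^ 2 * x ^ 2 * q ^ 3 - y ^ 2 * x * q ^ 2) ∧
    (#{z | quadraticChar F (Algebra.trace F K z ^ 2 - Q 1 * Q z) = -1} : ℚ)
      = (q - 1) / 2 * (y ^ 2 * x ^ 2 * q ^ 3 + y ^ 2 * x * q ^ 2) := by
  have hq0 : q ≠ 0 := by positivity
  have e0 := h.card_disc_eq h1 0
  have e1 := h.card_quadraticChar_disc_eq h1 (Or.inl rfl)
  have e2 := h.card_quadraticChar_disc_eq h1 (Or.inr rfl)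
  have e0' := congrArg (Int.cast : ℤ → ℚ) e0
  have e1' := congrArg (Int.cast : ℤ → ℚ) e1
  have e2' := congrArg (Int.cast : ℤ → ℚ) e2
  push_cast [MulChar.map_zero] at e0' e1' e2'
  rw [hF, hK, hS] at e0' e1' e2'
  refine ⟨?_, ?_, ?_⟩
  · refine mul_left_cancel₀ hq0 ?_
    linear_combination e0'
  · refine mul_left_cancel₀ hq0 ?_
    linear_combination e1' / 2
  · refine mul_left_cancel₀ hq0 ?_
    linear_combination e2' / 2

/-- The binary form has q + (q - 1)χ zeros, χ being the character of the discriminant, so its three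
values give the three weights. Words outside the image of A have the weight of χ = 0. -/
theorem code_of_zero_of_anisotropic (h : IsTraceQuadric Q A) (h1 : Q 1 ≠ 0)
    (hF : (Fintype.card F : ℚ) = q) (hq : 3 ≤ q) (hx : 1 ≤ x) (hy : 1 ≤ y)
    (hK : (Fintype.card K : ℚ) = y ^ 2 * x ^ 2 * q ^ 4) (hR : (#{y | A y = 0} : ℚ) = y ^ 2)
    (hS : (zeroExcess Q : ℚ) = -(y ^ 2 * x * q ^ 2)) :
    (#(traceSection Q 0) : ℚ) = y ^ 2 * x ^ 2 * q ^ 2 - 1 ∧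
    IsWeightCode 3 (traceCode F (traceSection Q 0)) ∧
    Module.finrank F (traceCode F (traceSection Q 0)) = Module.finrank F K - 1 ∧
    HasWeightDistribution (traceCode F (traceSection Q 0))
      [(0, 1),
       ((q - 1) * (y ^ 2 * x ^ 2 * q), y ^ 2 * x ^ 2 * q ^ 3 - (q - 1) * (x ^ 2 * q ^ 2) - 1),
       ((q - 1) * (y ^ 2 * x ^ 2 * q + y ^ 2 * x), 1 / 2 * (q - 1) * (x ^ 2 * q ^ 2 - x * q)),
       ((q - 1) * (y ^ 2 * x ^ 2 * q - y ^ 2 * x), 1 / 2 * (q - 1) * (x ^ 2 * q ^ 2 + x * q))] ∧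
    ∃ d : ℕ, (d : ℚ) = (q - 1) * (y ^ 2 * x ^ 2 * q - y ^ 2 * x) ∧
      HasMinDistance (traceCode F (traceSection Q 0)) d := by
  have hM : (#{t | Q 1 * t ^ 2 = -(0 : F)} : ℚ) = 1 := by
    have := card_filter_mul_sq_eq h.ringChar_ne_two h1 (-(0 : F))
    rw [neg_zero, mul_zero, MulChar.map_zero, add_zero] at this
    rw [neg_zero]
    exact_mod_cast this
  have hM₂ : ∀ z : K, (#{c : F × F | Q 1 * c.1 ^ 2 + 2 * c.1 * c.2 * Algebra.trace F K z
      + c.2 ^ 2 * Q z = -0} : ℚ)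
      = q + (q - 1) * (quadraticChar F (Algebra.trace F K z ^ 2 - Q 1 * Q z) : ℤ) := by
    intro z
    rw [neg_zero, ← hF]
    exact_mod_cast card_binary_zero h.ringChar_ne_two h1
  obtain ⟨n₁, n₂, n₃⟩ := h.card_disc_classes h1 hF hq hK hS
  have hw := fun z hz => h.weight_apply_eq 0 hF hq hK hS hM z hz (hM₂ z)
  have hxy : 0 < y ^ 2 * x := by positivity
  have hxq1 : 1 < x * q := by nlinarith
  have hxq : y ^ 2 * x < y ^ 2 * x ^ 2 * q := by
    have := mul_lt_mul_of_pos_left hxq1 hxy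
    linarith
  obtain ⟨g₁₂, g₁₃, g₂₃, g₁, g₂, g₃, g₄, g₅⟩ := separated_weights (by linarith : 0 < q - 1) hxy hxq
  have main := h.traceCode_of_classes (0 : F) (R := y ^ 2)
    (r₁ := (q - 1) * (y ^ 2 * x ^ 2 * q)) (r₂ := (q - 1) * (y ^ 2 * x ^ 2 * q + y ^ 2 * x))
    (r₃ := (q - 1) * (y ^ 2 * x ^ 2 * q - y ^ 2 * x))
    (a₁ := y ^ 2 * x ^ 2 * q ^ 3 - (q - 1) * (x ^ 2 * q ^ 2) - 1)
    (a₂ := 1 / 2 * (q - 1) * (x ^ 2 * q ^ 2 - x * q))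
    (a₃ := 1 / 2 * (q - 1) * (x ^ 2 * q ^ 2 + x * q))
    (fun z => Algebra.trace F K z ^ 2 - Q 1 * Q z = 0)
    (fun z => quadraticChar F (Algebra.trace F K z ^ 2 - Q 1 * Q z) = 1)
    (fun z => quadraticChar F (Algebra.trace F K z ^ 2 - Q 1 * Q z) = -1)
    hR g₁₂ g₁₃ g₂₃ g₁ g₂ g₃ (frequency_pos hq hx hy) ?_ ?_ (Or.inl rfl) ?_ ?_ ?_ ?_ ?_ ?_ ?_
    ?_ ?_ ?_
  · refine ⟨?_, main.1, main.2.1, main.2.2.1, main.2.2.2 _ (Or.inr (Or.inr rfl)) g₄ g₅ le_rfl⟩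
    rw [h.card_traceSection_eq 0 hF hq hK hS, hM, if_pos rfl]
    ring
  · have h3 : 0 < x * q * (x * q - 1) := mul_pos (by positivity) (by linarith)
    exact mul_pos (by linarith) (by linarith)
  · exact mul_pos (by linarith) (by positivity)
  · intro b hb
    rw [h.weight_off_range_eq 0 hF hq hK hS hM b hb]
    ring
  · intro z
    by_cases hz : Algebra.trace F K z ^ 2 - Q 1 * Q z = 0
    · exact Or.inl hz
    · exact Or.inr (quadraticChar_dichotomy hz)
  · intro z hz
    have := h.disc_eq_zero_of_apply_mem_range hz
    rw [this, MulChar.map_zero]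
    norm_num
  · intro z hz hd
    rw [hw z hz, hd, MulChar.map_zero]
    push_cast
    ring
  · intro z hz hd
    rw [hw z hz, hd]
    push_cast
    ring
  · intro z hz hd
    rw [hw z hz, hd]
    push_cast
    ring
  · rw [if_pos rfl, n₁, hF, hK]
    ring
  · rw [if_neg g₁₂, n₂, hF]
    ring
  · rw [if_neg g₁₃, n₃, hF]
    ring
  · rw [hF, hK]
    ring

end IsTraceQuadric

end FourCases

/-! ### The cases Q(1) = 0, and u ≠ 0 with Q(1) ≠ 0 -/

section RemainingCases

open Finset QuadraticMap

variable {F K : Type*} [Field F] [Field K] [Fintype F] [Fintype K] [Algebra F K]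
  [DecidableEq F] [DecidableEq K]

theorem pow_sub_pow_frequency_pos {q x y : ℚ} (hq : 3 ≤ q) (hx : 1 ≤ x) (hy : 1 ≤ y) :
    0 < y ^ 2 * x ^ 2 * q ^ 3 - x ^ 2 * q ^ 2 := by
  have e1 : 1 * (x ^ 2 * q ^ 3) ≤ y ^ 2 * (x ^ 2 * q ^ 3) :=
    mul_le_mul_of_nonneg_right (one_le_pow₀ hy) (by positivity)
  have e2 : 0 < x ^ 2 * q ^ 2 * (q - 1) := mul_pos (by positivity) (by linarith)
  linarith

namespace IsTraceQuadric

variable {Q : QuadraticForm F K} {A : K →ₗ[F] K} {q x y : ℚ}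

theorem values_of_apply_mem_range_of_isotropic (h : IsTraceQuadric Q A) (h1 : Q 1 = 0) {z : K}
    (hz : ∃ c, algebraMap F K c = A z) : Algebra.trace F K z = 0 ∧ Q z = 0 := by
  obtain ⟨t, h2, h3⟩ := h.values_of_apply_mem_range hz
  rw [h1, zero_mul] at h2 h3
  exact ⟨h2, h3⟩

theorem card_trace_classes (h : IsTraceQuadric Q A) (h1 : Q 1 = 0)
    (hF : (Fintype.card F : ℚ) = q)
    (hq : 3 ≤ q) (hK : (Fintype.card K : ℚ) = y ^ 2 * x ^ 2 * q ^ 4)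
    (hS : (zeroExcess Q : ℚ) = -(y ^ 2 * x * q ^ 2)) :
    (#{z | Algebra.trace F K z = 0 ∧ Q z = 0} : ℚ)
      = y ^ 2 * x ^ 2 * q ^ 2 - y ^ 2 * x * q * (q - 1) ∧
    (#{z | Algebra.trace F K z = 0 ∧ Q z ≠ 0} : ℚ)
      = y ^ 2 * x ^ 2 * q ^ 3 - y ^ 2 * x ^ 2 * q ^ 2 + y ^ 2 * x * q * (q - 1) ∧
    (#{z : K | Algebra.trace F K z ≠ 0} : ℚ) = y ^ 2 * x ^ 2 * q ^ 4 - y ^ 2 * x ^ 2 * q ^ 3 := by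
  have hq0 : q ≠ 0 := by positivity
  have e0 := congrArg (Int.cast : ℤ → ℚ) (h.card_trace_eq_zero_of_isotropic h1 0)
  have e1 := congrArg (Int.cast : ℤ → ℚ) (card_filter_trace_eq_zero F K)
  have e2 : (#{z | Algebra.trace F K z = 0 ∧ Q z = 0} : ℚ)
      + #{z | Algebra.trace F K z = 0 ∧ Q z ≠ 0} = #{z : K | Algebra.trace F K z = 0} := by
    have := card_filter_add_card_filter_not (s := {z : K | Algebra.trace F K z = 0})
      (fun z => Q z = 0)
    rw [filter_filter, filter_filter] at this
    exact_mod_cast this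
  have e3 : (#{z : K | Algebra.trace F K z = 0} : ℚ) + #{z : K | Algebra.trace F K z ≠ 0}
      = Fintype.card K := by
    have := card_filter_add_card_filter_not (s := (univ : Finset K))
      (fun z => Algebra.trace F K z = 0)
    rw [card_univ] at this
    exact_mod_cast this
  simp only [if_true] at e0
  push_cast at e0 e1
  rw [hF, hK, hS] at e0
  rw [hF, hK] at e1
  rw [hK] at e3
  simp_rw [and_comm (a := Q _ = 0)] at e0
  have f0 : (#{z | Algebra.trace F K z = 0 ∧ Q z = 0} : ℚ)
      = y ^ 2 * x ^ 2 * q ^ 2 - y ^ 2 * x * q * (q - 1) := by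
    refine mul_left_cancel₀ (pow_ne_zero 2 hq0) ?_
    linear_combination e0
  have f1 : (#{z : K | Algebra.trace F K z = 0} : ℚ) = y ^ 2 * x ^ 2 * q ^ 3 := by
    refine mul_left_cancel₀ hq0 ?_
    linear_combination e1
  refine ⟨f0, ?_, ?_⟩
  · linear_combination e2 + f1 - f0
  · linear_combination e3 - f1

/-- The binary form is zero, of rank one or hyperbolic, with q², q or 2q - 1 zeros; words outside
the image of A behave as in the hyperbolic case. The bound q ≤ x is essential: at x = 1 the smallest
weight and the first frequency would both vanish. -/
theorem code_of_zero_of_isotropic (h : IsTraceQuadric Q A) (h1 : Q 1 = 0)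
    (hF : (Fintype.card F : ℚ) = q) (hq : 3 ≤ q) (hx : q ≤ x) (hy : 1 ≤ y)
    (hK : (Fintype.card K : ℚ) = y ^ 2 * x ^ 2 * q ^ 4) (hR : (#{y | A y = 0} : ℚ) = y ^ 2)
    (hS : (zeroExcess Q : ℚ) = -(y ^ 2 * x * q ^ 2)) :
    (#(traceSection Q 0) : ℚ) = y ^ 2 * x ^ 2 * q ^ 2 - (q - 1) * (y ^ 2 * x * q) - 1 ∧
    IsWeightCode 3 (traceCode F (traceSection Q 0)) ∧
    Module.finrank F (traceCode F (traceSection Q 0)) = Module.finrank F K - 1 ∧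
    HasWeightDistribution (traceCode F (traceSection Q 0))
      [(0, 1),
       ((q - 1) * (y ^ 2 * x ^ 2 * q), x ^ 2 * q - (q - 1) * x - 1),
       ((q - 1) * (y ^ 2 * x ^ 2 * q - y ^ 2 * x * q), (q - 1) * (x ^ 2 * q + x)),
       ((q - 1) * (y ^ 2 * x ^ 2 * q + y ^ 2 * x - y ^ 2 * x * q),
        y ^ 2 * x ^ 2 * q ^ 3 - x ^ 2 * q ^ 2)] ∧
    ∃ d : ℕ, (d : ℚ) = (q - 1) * (y ^ 2 * x ^ 2 * q - y ^ 2 * x * q) ∧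
      HasMinDistance (traceCode F (traceSection Q 0)) d := by
  have hM : (#{t | Q 1 * t ^ 2 = -(0 : F)} : ℚ) = q := by
    simp [h1, hF]
  have hw := fun z hz => h.weight_apply_eq 0 hF hq hK hS hM z hz rfl
  simp only [h1, neg_zero] at hw
  obtain ⟨n₁, n₂, n₃⟩ := h.card_trace_classes h1 hF hq hK hS
  have hp : 0 < q - 1 := by linarith
  have hx1 : 1 ≤ x := by linarith
  have hg : 0 < y ^ 2 * x := by positivity
  have hgq : 0 < (q - 1) * (y ^ 2 * x) := mul_pos hp hg
  have hr : y ^ 2 * x * q < y ^ 2 * x ^ 2 * q := by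
    have := mul_lt_mul_of_pos_left (by linarith : 1 < x) (by positivity : 0 < y ^ 2 * x * q)
    linarith
  have hpr : 0 < (q - 1) * (y ^ 2 * x ^ 2 * q - y ^ 2 * x * q) := mul_pos hp (by linarith)
  have hgq2 : 0 < (q - 1) * ((q - 1) * (y ^ 2 * x)) := mul_pos hp hgq
  have main := h.traceCode_of_classes (0 : F) (R := y ^ 2)
    (w := (q - 1) * (y ^ 2 * x ^ 2 * q + y ^ 2 * x - y ^ 2 * x * q))
    (r₁ := (q - 1) * (y ^ 2 * x ^ 2 * q)) (r₂ := (q - 1) * (y ^ 2 * x ^ 2 * q - y ^ 2 * x * q))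
    (r₃ := (q - 1) * (y ^ 2 * x ^ 2 * q + y ^ 2 * x - y ^ 2 * x * q))
    (a₁ := x ^ 2 * q - (q - 1) * x - 1)
    (a₂ := (q - 1) * (x ^ 2 * q + x))
    (a₃ := y ^ 2 * x ^ 2 * q ^ 3 - x ^ 2 * q ^ 2)
    (fun z => Algebra.trace F K z = 0 ∧ Q z = 0)
    (fun z => Algebra.trace F K z = 0 ∧ Q z ≠ 0)
    (fun z => Algebra.trace F K z ≠ 0)
    hR (ne_of_gt (by linarith)) (ne_of_gt (by linarith)) (ne_of_lt (by linarith))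
    (ne_of_gt (by linarith)) (ne_of_gt (by linarith)) (ne_of_gt (by linarith)) ?_
    (mul_pos hp (by positivity)) (pow_sub_pow_frequency_pos hq hx1 hy) (Or.inr (Or.inr rfl))
    ?_ ?_ ?_ ?_ ?_ ?_ ?_ ?_ ?_ ?_
  · refine ⟨?_, main.1, main.2.1, main.2.2.1,
      main.2.2.2 _ (Or.inr (Or.inl rfl)) (by linarith) le_rfl (by linarith)⟩
    rw [h.card_traceSection_eq 0 hF hq hK hS, hM, if_pos rfl]
    ring
  · have : 0 ≤ x * q * (x - 1) := mul_nonneg (by positivity) (by linarith)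
    nlinarith
  · intro b hb
    rw [h.weight_off_range_eq 0 hF hq hK hS hM b hb]
    ring
  · intro z
    by_cases hz : Algebra.trace F K z = 0
    · by_cases hz' : Q z = 0
      · exact Or.inl ⟨hz, hz'⟩
      · exact Or.inr (Or.inl ⟨hz, hz'⟩)
    · exact Or.inr (Or.inr hz)
  · intro z hz
    have := h.values_of_apply_mem_range_of_isotropic h1 hz
    exact ⟨this, fun g => g.2 this.2, fun g => g this.1⟩
  · rintro z hz ⟨hd, hd'⟩
    have e := congrArg (Int.cast : ℤ → ℚ) (card_binary_rank_zero (0 : F))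
    simp only [if_true] at e
    push_cast at e
    rw [hw z hz, hd, hd', e, hF]
    ring
  · rintro z hz ⟨hd, hd'⟩
    have e := congrArg (Int.cast : ℤ → ℚ) (card_binary_rank_one h.ringChar_ne_two hd' 0)
    rw [mul_zero, MulChar.map_zero] at e
    push_cast at e
    rw [hw z hz, hd, e, hF]
    ring
  · rintro z hz hd
    have e := congrArg (Int.cast : ℤ → ℚ) (card_binary_hyperbolic h.two_ne hd (Q z) 0)
    simp only [if_true] at e
    push_cast at e
    rw [hw z hz, e, hF]
    ring
  · rw [if_neg (ne_of_lt (by linarith)), n₁, hF]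
    ring
  · rw [if_neg (ne_of_gt (by linarith)), n₂, hF]
    ring
  · rw [if_pos rfl, n₃, hF, hK]
    ring
  · rw [hF, hK]
    ring

/-- The value -u is taken 2q, 0 or q - 1 times by the binary form. The count 0 arises both from the
zero form and from rank one with -u Q(y) a nonsquare, and these share the first class. -/
theorem code_of_ne_zero_of_isotropic (h : IsTraceQuadric Q A) (h1 : Q 1 = 0) {u : F} (hu : u ≠ 0)
    (hF : (Fintype.card F : ℚ) = q) (hq : 3 ≤ q) (hx : q ≤ x) (hy : 1 ≤ y)
    (hK : (Fintype.card K : ℚ) = y ^ 2 * x ^ 2 * q ^ 4) (hR : (#{y | A y = 0} : ℚ) = y ^ 2)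
    (hS : (zeroExcess Q : ℚ) = -(y ^ 2 * x * q ^ 2)) :
    (#(traceSection Q u) : ℚ) = y ^ 2 * x ^ 2 * q ^ 2 + y ^ 2 * x * q ∧
    IsWeightCode 3 (traceCode F (traceSection Q u)) ∧
    Module.finrank F (traceCode F (traceSection Q u)) = Module.finrank F K - 1 ∧
    HasWeightDistribution (traceCode F (traceSection Q u))
      [(0, 1),
       ((q - 1) * (y ^ 2 * x ^ 2 * q), x ^ 2 * q ^ 2 - 1 / 2 * (q - 1) * (x ^ 2 * q + x) - 1),
       ((q - 1) * (y ^ 2 * x ^ 2 * q) + 2 * (y ^ 2 * x * q), 1 / 2 * (q - 1) * (x ^ 2 * q + x)),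
       ((q - 1) * (y ^ 2 * x ^ 2 * q + y ^ 2 * x), y ^ 2 * x ^ 2 * q ^ 3 - x ^ 2 * q ^ 2)] ∧
    ∃ d : ℕ, (d : ℚ) = (q - 1) * (y ^ 2 * x ^ 2 * q) ∧
      HasMinDistance (traceCode F (traceSection Q u)) d := by
  have hu' : -u ≠ 0 := neg_ne_zero.mpr hu
  have hM : (#{t | Q 1 * t ^ 2 = -u} : ℚ) = 0 := by
    simp [h1, hu'.symm]
  have hw := fun z hz => h.weight_apply_eq u hF hq hK hS hM z hz rfl
  simp only [h1] at hw
  obtain ⟨n₁, n₂, n₃⟩ := h.card_trace_classes h1 hF hq hK hS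
  have m₂ : (#{z | Algebra.trace F K z = 0 ∧ quadraticChar F (-u * Q z) = 1} : ℚ)
      = (q - 1) / 2 * (y ^ 2 * x ^ 2 * q ^ 2 + y ^ 2 * x * q) := by
    have e := congrArg (Int.cast : ℤ → ℚ) (h.card_quadraticChar_of_isotropic h1 hu')
    push_cast at e
    rw [hF, hK, hS] at e
    have hq0 : q ^ 2 ≠ 0 := by positivity
    refine mul_left_cancel₀ hq0 ?_
    linear_combination e / 2
  have m₁ : (#{z | Algebra.trace F K z = 0 ∧ ¬ quadraticChar F (-u * Q z) = 1} : ℚ)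
      = y ^ 2 * x ^ 2 * q ^ 3 - (q - 1) / 2 * (y ^ 2 * x ^ 2 * q ^ 2 + y ^ 2 * x * q) := by
    have e1 := card_filter_add_card_filter_not (s := {z : K | Algebra.trace F K z = 0})
      (fun z => Q z = 0)
    have e2 := card_filter_add_card_filter_not (s := {z : K | Algebra.trace F K z = 0})
      (fun z => quadraticChar F (-u * Q z) = 1)
    rw [filter_filter, filter_filter] at e1 e2
    rw [← e1] at e2
    have e3 := congrArg (Nat.cast : ℕ → ℚ) e2
    push_cast at e3
    linear_combination e3 - m₂ + n₁ + n₂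
  have hp : 0 < q - 1 := by linarith
  have hx1 : 1 ≤ x := by linarith
  have hg : 0 < y ^ 2 * x := by positivity
  have hgq : 0 < (q - 1) * (y ^ 2 * x) := mul_pos hp hg
  have hpr : 0 < (q - 1) * (y ^ 2 * x ^ 2 * q) := mul_pos hp (by positivity)
  have hgq2 : 0 < y ^ 2 * x * q := by positivity
  have main := h.traceCode_of_classes u (R := y ^ 2)
    (w := (q - 1) * (y ^ 2 * x ^ 2 * q + y ^ 2 * x))
    (r₁ := (q - 1) * (y ^ 2 * x ^ 2 * q))
    (r₂ := (q - 1) * (y ^ 2 * x ^ 2 * q) + 2 * (y ^ 2 * x * q))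
    (r₃ := (q - 1) * (y ^ 2 * x ^ 2 * q + y ^ 2 * x))
    (a₁ := x ^ 2 * q ^ 2 - 1 / 2 * (q - 1) * (x ^ 2 * q + x) - 1)
    (a₂ := 1 / 2 * (q - 1) * (x ^ 2 * q + x))
    (a₃ := y ^ 2 * x ^ 2 * q ^ 3 - x ^ 2 * q ^ 2)
    (fun z => Algebra.trace F K z = 0 ∧ ¬ quadraticChar F (-u * Q z) = 1)
    (fun z => Algebra.trace F K z = 0 ∧ quadraticChar F (-u * Q z) = 1)
    (fun z => Algebra.trace F K z ≠ 0)
    hR (ne_of_lt (by linarith)) (ne_of_lt (by linarith)) (ne_of_gt (by linarith))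
    (ne_of_gt (by linarith)) (ne_of_gt (by linarith)) (ne_of_gt (by linarith)) ?_
    (mul_pos (by linarith) (by positivity)) (pow_sub_pow_frequency_pos hq hx1 hy)
    (Or.inr (Or.inr rfl)) ?_ ?_ ?_ ?_ ?_ ?_ ?_ ?_ ?_ ?_
  · refine ⟨?_, main.1, main.2.1, main.2.2.1,
      main.2.2.2 _ (Or.inl rfl) le_rfl (by linarith) (by linarith)⟩
    rw [h.card_traceSection_eq u hF hq hK hS, hM, if_neg hu]
    ring
  · have e1 : x * q ≤ x ^ 2 * q := by
      have : 0 ≤ x * q * (x - 1) := mul_nonneg (by positivity) (by linarith)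
      linarith
    have e2 : 3 * (x ^ 2 * q) ≤ x ^ 2 * q ^ 2 := by
      have : 0 ≤ x ^ 2 * q * (q - 3) := mul_nonneg (by positivity) (by linarith)
      linarith
    have e3 : 3 ≤ x * q := by nlinarith
    linarith
  · intro b hb
    rw [h.weight_off_range_eq u hF hq hK hS hM b hb]
    ring
  · intro z
    by_cases hz : Algebra.trace F K z = 0
    · by_cases hz' : quadraticChar F (-u * Q z) = 1
      · exact Or.inr (Or.inl ⟨hz, hz'⟩)
      · exact Or.inl ⟨hz, hz'⟩
    · exact Or.inr (Or.inr hz)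
  · intro z hz
    obtain ⟨t1, t2⟩ := h.values_of_apply_mem_range_of_isotropic h1 hz
    rw [t1, t2, mul_zero, MulChar.map_zero]
    norm_num
  · rintro z hz ⟨hd, hd'⟩
    by_cases hz0 : Q z = 0
    · have e := congrArg (Int.cast : ℤ → ℚ) (card_binary_rank_zero (-u))
      rw [if_neg hu'] at e
      push_cast at e
      rw [hw z hz, hd, hz0, e]
      ring
    · have e := congrArg (Int.cast : ℤ → ℚ) (card_binary_rank_one h.ringChar_ne_two hz0 (-u))
      rw [mul_comm (Q z), (quadraticChar_dichotomy (mul_ne_zero hu' hz0)).resolve_left hd'] at e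
      push_cast at e
      rw [hw z hz, hd, e]
      ring
  · rintro z hz ⟨hd, hd'⟩
    have hz0 : Q z ≠ 0 := by
      intro h0
      rw [h0, mul_zero, MulChar.map_zero] at hd'
      norm_num at hd'
    have e := congrArg (Int.cast : ℤ → ℚ) (card_binary_rank_one h.ringChar_ne_two hz0 (-u))
    rw [mul_comm (Q z), hd'] at e
    push_cast at e
    rw [hw z hz, hd, e, hF]
    ring
  · rintro z hz hd
    have e := congrArg (Int.cast : ℤ → ℚ) (card_binary_hyperbolic h.two_ne hd (Q z) (-u))
    rw [if_neg hu'] at e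
    push_cast at e
    rw [hw z hz, e, hF]
    ring
  · rw [if_neg (ne_of_gt (by linarith)), m₁, hF]
    ring
  · rw [if_neg (ne_of_lt (by linarith)), m₂, hF]
    ring
  · rw [if_pos rfl, n₃, hF, hK]
    ring
  · rw [hF, hK]
    ring

/-- The value -u is taken q(1 + η) times when the discriminant vanishes, and q - χ times otherwise.
Words outside the image of A join the class χ = -η, hence the terms in η in the last two
frequencies. -/
theorem code_of_ne_zero_of_anisotropic (h : IsTraceQuadric Q A) (h1 : Q 1 ≠ 0) {u : F}
    (hu : u ≠ 0) (hF : (Fintype.card F : ℚ) = q) (hq : 3 ≤ q) (hx : 1 ≤ x) (hy : 1 ≤ y)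
    (hK : (Fintype.card K : ℚ) = y ^ 2 * x ^ 2 * q ^ 4) (hR : (#{y | A y = 0} : ℚ) = y ^ 2)
    (hS : (zeroExcess Q : ℚ) = -(y ^ 2 * x * q ^ 2)) {η : ℚ}
    (hη : η = (quadraticChar F (-u * Q 1) : ℚ)) :
    (#(traceSection Q u) : ℚ) = y ^ 2 * x ^ 2 * q ^ 2 - y ^ 2 * x * q * η ∧
    IsWeightCode 3 (traceCode F (traceSection Q u)) ∧
    Module.finrank F (traceCode F (traceSection Q u)) = Module.finrank F K - 1 ∧
    HasWeightDistribution (traceCode F (traceSection Q u))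
      [(0, 1),
       ((q - 1) * (y ^ 2 * x ^ 2 * q), x ^ 2 * q ^ 2 - 1),
       ((q - 1) * (y ^ 2 * x ^ 2 * q) - y ^ 2 * x * q * η + y ^ 2 * x,
        1 / 2 * (y ^ 2 * x ^ 2 * q ^ 3 - x ^ 2 * q ^ 2 - x ^ 2 * q ^ 3 * η
          + y ^ 2 * x ^ 2 * q ^ 3 * η + x * q ^ 2 - x * q)),
       ((q - 1) * (y ^ 2 * x ^ 2 * q) - y ^ 2 * x * q * η - y ^ 2 * x,
        1 / 2 * (y ^ 2 * x ^ 2 * q ^ 3 - x ^ 2 * q ^ 2 + x ^ 2 * q ^ 3 * η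
          - y ^ 2 * x ^ 2 * q ^ 3 * η - x * q ^ 2 + x * q))] := by
  have hu' : -u ≠ 0 := neg_ne_zero.mpr hu
  have hηd : η = 1 ∨ η = -1 := by
    rcases quadraticChar_dichotomy (mul_ne_zero hu' h1) with g | g <;> rw [hη, g] <;> simp
  have hM : (#{t | Q 1 * t ^ 2 = -u} : ℚ) = 1 + η := by
    have := congrArg (Int.cast : ℤ → ℚ) (card_filter_mul_sq_eq h.ringChar_ne_two h1 (-u))
    rw [mul_comm (Q 1)] at this
    push_cast at this
    rw [this, hη]
  have hw := fun z hz => h.weight_apply_eq u hF hq hK hS hM z hz rfl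
  obtain ⟨n₁, n₃, n₂⟩ := h.card_disc_classes h1 hF hq hK hS
  have hp : 0 < q - 1 := by linarith
  have hg : 0 < y ^ 2 * x := by positivity
  have hgq : 0 < (q - 1) * (y ^ 2 * x) := mul_pos hp hg
  have hpr : 0 < (q - 1) * (y ^ 2 * x ^ 2 * q) - y ^ 2 * x * q - y ^ 2 * x := by
    have e1 : 0 ≤ y ^ 2 * x * q * (q - 1) * (x - 1) :=
      mul_nonneg (mul_nonneg (by positivity) hp.le) (by linarith)
    have e2 : 0 < y ^ 2 * x * (q * (q - 2) - 1) := mul_pos hg (by nlinarith)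
    linarith
  have hxq1 : 1 < x * q := by nlinarith
  have hxq2 : 0 < x * q * (x * q - 1) := mul_pos (by positivity) (by linarith)
  have hxq3 : 0 < (q - 1) * (x * q * (x * q - 1)) := mul_pos hp hxq2
  have hyx : 0 ≤ (y ^ 2 - 1) * (x ^ 2 * q ^ 3) :=
    mul_nonneg (sub_nonneg.mpr (one_le_pow₀ hy)) (by positivity)
  have hxq4 : 0 < (q - 1) * (x * q) := mul_pos hp (by positivity)
  have hxq5 : 0 < (q - 1) * (x ^ 2 * q ^ 2) := mul_pos hp (by positivity)
  have hgq3 : 0 < y ^ 2 * x * q := by positivity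
  have main := h.traceCode_of_classes u (R := y ^ 2)
    (w := (q - 1) * (y ^ 2 * x ^ 2 * q) - y ^ 2 * x * q * η + y ^ 2 * x * η)
    (r₁ := (q - 1) * (y ^ 2 * x ^ 2 * q))
    (r₂ := (q - 1) * (y ^ 2 * x ^ 2 * q) - y ^ 2 * x * q * η + y ^ 2 * x)
    (r₃ := (q - 1) * (y ^ 2 * x ^ 2 * q) - y ^ 2 * x * q * η - y ^ 2 * x)
    (a₁ := x ^ 2 * q ^ 2 - 1)
    (a₂ := 1 / 2 * (y ^ 2 * x ^ 2 * q ^ 3 - x ^ 2 * q ^ 2 - x ^ 2 * q ^ 3 * η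
          + y ^ 2 * x ^ 2 * q ^ 3 * η + x * q ^ 2 - x * q))
    (a₃ := 1 / 2 * (y ^ 2 * x ^ 2 * q ^ 3 - x ^ 2 * q ^ 2 + x ^ 2 * q ^ 3 * η
          - y ^ 2 * x ^ 2 * q ^ 3 * η - x * q ^ 2 + x * q))
    (fun z => Algebra.trace F K z ^ 2 - Q 1 * Q z = 0)
    (fun z => quadraticChar F (Algebra.trace F K z ^ 2 - Q 1 * Q z) = -1)
    (fun z => quadraticChar F (Algebra.trace F K z ^ 2 - Q 1 * Q z) = 1)
    hR ?_ ?_ (ne_of_gt (by linarith)) (ne_of_gt (by linarith)) ?_ ?_ (by linarith) ?_ ?_ ?_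
    ?_ ?_ ?_ ?_ ?_ ?_ ?_ ?_ ?_ ?_
  · refine ⟨?_, main.1, main.2.1, main.2.2.1⟩
    rw [h.card_traceSection_eq u hF hq hK hS, hM, if_neg hu]
    ring
  · rcases hηd with rfl | rfl
    · exact ne_of_gt (by linarith)
    · exact ne_of_lt (by linarith)
  · rcases hηd with rfl | rfl
    · exact ne_of_gt (by linarith)
    · exact ne_of_lt (by linarith)
  · rcases hηd with rfl | rfl <;> exact ne_of_gt (by linarith)
  · rcases hηd with rfl | rfl <;> exact ne_of_gt (by linarith)
  · rcases hηd with rfl | rfl <;> linarith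
  · rcases hηd with rfl | rfl <;> linarith
  · rcases hηd with rfl | rfl
    · exact Or.inr (Or.inl (by ring))
    · exact Or.inr (Or.inr (by ring))
  · intro b hb
    rw [h.weight_off_range_eq u hF hq hK hS hM b hb]
    ring
  · intro z
    by_cases hz : Algebra.trace F K z ^ 2 - Q 1 * Q z = 0
    · exact Or.inl hz
    · exact Or.inr (quadraticChar_dichotomy hz).symm
  · intro z hz
    have := h.disc_eq_zero_of_apply_mem_range hz
    rw [this, MulChar.map_zero]
    norm_num
  · intro z hz hd
    have e := congrArg (Int.cast : ℤ → ℚ)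
      (card_binary_of_disc_eq_zero h.ringChar_ne_two h1 (-u) hd)
    rw [mul_comm (Q 1) (-u)] at e
    push_cast at e
    rw [hw z hz, e, hF, hη]
    ring
  · intro z hz hd
    have hd0 : Algebra.trace F K z ^ 2 - Q 1 * Q z ≠ 0 := by
      intro h0
      rw [h0, MulChar.map_zero] at hd
      norm_num at hd
    have e := congrArg (Int.cast : ℤ → ℚ) (card_binary_of_ne_zero h.ringChar_ne_two h1 hu' hd0)
    rw [hd] at e
    push_cast at e
    rw [hw z hz, e, hF]
    ring
  · intro z hz hd
    have hd0 : Algebra.trace F K z ^ 2 - Q 1 * Q z ≠ 0 := by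
      intro h0
      rw [h0, MulChar.map_zero] at hd
      norm_num at hd
    have e := congrArg (Int.cast : ℤ → ℚ) (card_binary_of_ne_zero h.ringChar_ne_two h1 hu' hd0)
    rw [hd] at e
    push_cast at e
    rw [hw z hz, e, hF]
    ring
  · rw [if_neg, n₁, hF]
    · ring
    · rcases hηd with rfl | rfl
      · exact ne_of_lt (by linarith)
      · exact ne_of_gt (by linarith)
  · rcases hηd with rfl | rfl
    · rw [if_pos (by ring), n₂, hF, hK]
      ring
    · rw [if_neg (ne_of_lt (by linarith)), n₂, hF]
      ring
  · rcases hηd with rfl | rfl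
    · rw [if_neg (ne_of_gt (by linarith)), n₃, hF]
      ring
    · rw [if_pos (by ring), n₃, hF, hK]
      ring
  · rw [hF, hK]
    ring

end IsTraceQuadric

end RemainingCases

/-! ### Arithmetic of the parameters ℓ, e, ε -/

section Parameters

open Finset QuadraticMap

/-- For s odd, ε = 0 and ℓ ≥ p ≥ 3. For s = 2r the odd prime p divides g or r, and then 2gr ≥ g + 3.
So when m = 0 in F the lower bound on m is automatic, with one to spare. -/
theorem add_three_le_of_dvd {p g s ℓ ε : ℕ} (hp : p.Prime) (hp2 : p ≠ 2) (hℓ : ℓ = g * s)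
    (hℓ0 : 0 < ℓ) (hε : ε = if Odd s then 0 else g) (hdvd : p ∣ ℓ) : ε + 3 ≤ ℓ := by
  have hp3 : 3 ≤ p := by
    have := hp.two_le
    omega
  split_ifs at hε with hs
  · have := Nat.le_of_dvd hℓ0 hdvd
    omega
  · obtain ⟨r, rfl⟩ := Nat.not_odd_iff_even.mp hs
    have hg : 0 < g := Nat.pos_of_mul_pos_right (hℓ ▸ hℓ0)
    have hr : 0 < r := by
      rcases Nat.eq_zero_or_pos r with h | h
      · simp [h] at hℓ
        omega
      · exact h
    have h1 : p ∣ 2 * (g * r) := by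
      have : 2 * (g * r) = ℓ := by rw [hℓ]; ring
      rwa [this]
    have h2 : p ∣ g * r :=
      (hp.dvd_mul.mp h1).resolve_left fun h =>
        hp2 ((Nat.prime_dvd_prime_iff_eq hp Nat.prime_two).mp h)
    rcases hp.dvd_mul.mp h2 with h3 | h3
    · have := Nat.le_of_dvd hg h3
      nlinarith
    · have := Nat.le_of_dvd hr h3
      nlinarith

/-- The form `Tr (x ^ (q ^ e + 1))` has a radical of order `q ^ (2 ε)` and is of minus type. -/
theorem exists_isTraceQuadric_powForm {F K : Type*} [Field F] [Field K] [Fintype F] [Fintype K]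
    [DecidableEq F] [DecidableEq K] [Algebra F K] {p g s f ε : ℕ} [Fact p.Prime] [CharP F p]
    (hp : p ≠ 2) (hm : Module.finrank F K = 2 * g * s) (hg : 0 < g) (hs : 0 < s) (hf : Odd f)
    (hsf : Nat.Coprime s f) (hε : ε = if Odd s then 0 else g) :
    ∃ A : K →ₗ[F] K, IsTraceQuadric (powForm F K (g * f)) A ∧
      #{y | A y = 0} = Fintype.card F ^ (2 * ε) ∧
      zeroExcess (powForm F K (g * f)) = -(Fintype.card F : ℤ) ^ (g * s + ε) := by
  classical
  have hK : Fintype.card K = Fintype.card F ^ (2 * g * s) := by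
    rw [Module.card_eq_pow_finrank (K := F), hm]
  have h2 : (2 : F) ≠ 0 := by
    intro h
    have := (CharP.cast_eq_zero_iff F p 2).mp (by exact_mod_cast h)
    exact hp ((Nat.prime_dvd_prime_iff_eq Fact.out Nat.prime_two).mp this)
  have h2K : (2 : K) ≠ 0 := by
    rw [← map_ofNat (algebraMap F K) 2]
    simpa using h2
  have : CharP K p := charP_of_injective_algebraMap (algebraMap F K).injective p
  obtain ⟨k, hpr, hk⟩ := FiniteField.card F p
  have hodd : Odd (Fintype.card F) := by
    rw [hk]
    exact (hpr.odd_of_ne_two hp).pow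
  obtain ⟨A, hA⟩ := exists_polar_eq_trace (powForm F K (g * f))
  have h : IsTraceQuadric (powForm F K (g * f)) A :=
    ⟨h2, card_powForm_eq hK hf, polar_powForm_one _, hA⟩
  have hrad : #{y : K | ∀ x, polar (powForm F K (g * f)) x y = 0} = Fintype.card F ^ (2 * ε) := by
    simp_rw [polar_powForm_eq_zero_iff]
    rw [card_filter_pow_card_eq_neg hk Fintype.one_lt_card hodd h2K hK hg hs hf hsf, hε]
    split_ifs <;> simp
  refine ⟨A, h, ?_, ?_⟩
  · simp_rw [h.apply_eq_zero_iff]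
    exact hrad
  -- The definition of ε makes t odd in both cases: t = s when s is odd, t = s + 1 when s is even.
  · have ht : ∃ t, Odd t ∧ g * s + ε = g * t := by
      rw [hε]
      split_ifs with hs
      · exact ⟨s, hs, by ring⟩
      · exact ⟨s + 1, (Nat.not_odd_iff_even.mp hs).add_one, by ring⟩
    obtain ⟨t, ht, hst⟩ := ht
    rw [hst]
    refine zeroExcess_powForm h2 hK hg hf ht ?_
    rw [hrad, ← pow_add]
    congr 1
    rw [← hst]
    ring

end Parameters

/-! ### Assembly of the four cases -/

theorem theorem1 {F K : Type*} [Field F] [Field K] [Fintype F] [Fintype K]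
    [DecidableEq F] [DecidableEq K] [Algebra F K]
    (p q m ℓ e ε : ℕ) [Fact p.Prime] [CharP F p] (hp : p ≠ 2)
    (hq : Fintype.card F = q) (hm : Module.finrank F K = m) (hmℓ : m = 2 * ℓ)
    (he : 0 < e) (hme : Even (m / Nat.gcd m e)) (hε : ε = epsilonOf ℓ e)
    (hm3 : 3 < m) (hmε : (m : F) ≠ 0 → 2 * ε + 2 < m) (u : F)
    (D : Finset K) (hD : D = definingSetOne F K e u 0)
    (C : Submodule F (D → F)) (hC : C = traceCode F D) :
    IsWeightCode 3 C ∧ Module.finrank F C = m - 1 ∧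
    (u = 0 → (m : F) ≠ 0 →
      (D.card : ℚ) = (q : ℚ) ^ (m - 2) - 1 ∧
      (∃ d : ℕ, (d : ℚ) = ((q : ℚ) - 1) * ((q : ℚ) ^ (m - 3) - (q : ℚ) ^ (ℓ + ε - 2)) ∧
        HasMinDistance C d) ∧
      HasWeightDistribution C
        [(0, 1),
         (((q : ℚ) - 1) * (q : ℚ) ^ (m - 3),
          (q : ℚ) ^ (m - 1) - ((q : ℚ) - 1) * (q : ℚ) ^ (m - 2 * ε - 2) - 1),
         (((q : ℚ) - 1) * ((q : ℚ) ^ (m - 3) + (q : ℚ) ^ (ℓ + ε - 2)),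
          1 / 2 * ((q : ℚ) - 1) * ((q : ℚ) ^ (m - 2 * ε - 2) - (q : ℚ) ^ (ℓ - ε - 1))),
         (((q : ℚ) - 1) * ((q : ℚ) ^ (m - 3) - (q : ℚ) ^ (ℓ + ε - 2)),
          1 / 2 * ((q : ℚ) - 1) * ((q : ℚ) ^ (m - 2 * ε - 2) + (q : ℚ) ^ (ℓ - ε - 1)))]) ∧
    (u = 0 → (m : F) = 0 →
      (D.card : ℚ) = (q : ℚ) ^ (m - 2) - ((q : ℚ) - 1) * (q : ℚ) ^ (ℓ + ε - 1) - 1 ∧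
      (∃ d : ℕ, (d : ℚ) = ((q : ℚ) - 1) * ((q : ℚ) ^ (m - 3) - (q : ℚ) ^ (ℓ + ε - 1)) ∧
        HasMinDistance C d) ∧
      HasWeightDistribution C
        [(0, 1),
         (((q : ℚ) - 1) * (q : ℚ) ^ (m - 3),
          (q : ℚ) ^ (m - 2 * ε - 3) - ((q : ℚ) - 1) * (q : ℚ) ^ (ℓ - ε - 2) - 1),
         (((q : ℚ) - 1) * ((q : ℚ) ^ (m - 3) - (q : ℚ) ^ (ℓ + ε - 1)),
          ((q : ℚ) - 1) * ((q : ℚ) ^ (m - 2 * ε - 3) + (q : ℚ) ^ (ℓ - ε - 2))),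
         (((q : ℚ) - 1) *
            ((q : ℚ) ^ (m - 3) + (q : ℚ) ^ (ℓ + ε - 2) - (q : ℚ) ^ (ℓ + ε - 1)),
          (q : ℚ) ^ (m - 1) - (q : ℚ) ^ (m - 2 * ε - 2))]) ∧
    (u ≠ 0 → (m : F) ≠ 0 → ∀ η : ℚ, η = (quadraticChar F (-u * (m : F)) : ℚ) →
      (D.card : ℚ) = (q : ℚ) ^ (m - 2) - (q : ℚ) ^ (ℓ + ε - 1) * η ∧
      HasWeightDistribution C
        [(0, 1),
         (((q : ℚ) - 1) * (q : ℚ) ^ (m - 3), (q : ℚ) ^ (m - 2 * ε - 2) - 1),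
         (((q : ℚ) - 1) * (q : ℚ) ^ (m - 3) - (q : ℚ) ^ (ℓ + ε - 1) * η
            + (q : ℚ) ^ (ℓ + ε - 2),
          1 / 2 * ((q : ℚ) ^ (m - 1) - (q : ℚ) ^ (m - 2 * ε - 2)
            - (q : ℚ) ^ (m - 2 * ε - 1) * η + (q : ℚ) ^ (m - 1) * η
            + (q : ℚ) ^ (ℓ - ε) - (q : ℚ) ^ (ℓ - ε - 1))),
         (((q : ℚ) - 1) * (q : ℚ) ^ (m - 3) - (q : ℚ) ^ (ℓ + ε - 1) * η
            - (q : ℚ) ^ (ℓ + ε - 2),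
          1 / 2 * ((q : ℚ) ^ (m - 1) - (q : ℚ) ^ (m - 2 * ε - 2)
            + (q : ℚ) ^ (m - 2 * ε - 1) * η - (q : ℚ) ^ (m - 1) * η
            - (q : ℚ) ^ (ℓ - ε) + (q : ℚ) ^ (ℓ - ε - 1)))]) ∧
    (u ≠ 0 → (m : F) = 0 →
      (D.card : ℚ) = (q : ℚ) ^ (m - 2) + (q : ℚ) ^ (ℓ + ε - 1) ∧
      (∃ d : ℕ, (d : ℚ) = ((q : ℚ) - 1) * (q : ℚ) ^ (m - 3) ∧ HasMinDistance C d) ∧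
      HasWeightDistribution C
        [(0, 1),
         (((q : ℚ) - 1) * (q : ℚ) ^ (m - 3),
          (q : ℚ) ^ (m - 2 * ε - 2)
            - 1 / 2 * ((q : ℚ) - 1) * ((q : ℚ) ^ (m - 2 * ε - 3) + (q : ℚ) ^ (ℓ - ε - 2)) - 1),
         (((q : ℚ) - 1) * (q : ℚ) ^ (m - 3) + 2 * (q : ℚ) ^ (ℓ + ε - 1),
          1 / 2 * ((q : ℚ) - 1) * ((q : ℚ) ^ (m - 2 * ε - 3) + (q : ℚ) ^ (ℓ - ε - 2))),
         (((q : ℚ) - 1) * ((q : ℚ) ^ (m - 3) + (q : ℚ) ^ (ℓ + ε - 2)),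
          (q : ℚ) ^ (m - 1) - (q : ℚ) ^ (m - 2 * ε - 2))]) := by
  subst hC hmℓ hq
  have hDef : D = traceSection (powForm F K e) u := by
    rw [hD, definingSetOne, traceSection]
    simp only [powForm_apply]
  clear hD
  subst hDef
  set g := Nat.gcd (2 * ℓ) e with hg
  have hg0 : 0 < g := Nat.gcd_pos_of_pos_right _ he
  obtain ⟨s, hs⟩ := hme
  have hℓ : ℓ = g * s := by
    have h := Nat.mul_div_cancel' (Nat.gcd_dvd_left (2 * ℓ) e)
    rw [← hg, hs] at h
    linarith
  obtain ⟨f, hf⟩ : g ∣ e := Nat.gcd_dvd_right _ _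
  have hs0 : 0 < s := by
    rcases Nat.eq_zero_or_pos s with h | h
    · rw [h] at hℓ
      omega
    · exact h
  -- With e = g f and m = 2 g s, dividing out the gcd leaves 2s and f coprime; so f is odd, and
  -- coprime to s.
  have hcop : Nat.Coprime (2 * s) f := by
    have h : g * Nat.gcd (2 * s) f = g * 1 := by
      rw [← Nat.gcd_mul_left, mul_one, ← hf, (by rw [hℓ]; ring : g * (2 * s) = 2 * ℓ)]
    exact Nat.eq_of_mul_eq_mul_left hg0 h
  have hfodd : Odd f := Nat.Coprime.odd_of_left (Nat.Coprime.coprime_mul_right hcop)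
  have hε' : ε = if Odd s then 0 else g := by
    rw [hε, epsilonOf, ← hg]
    congr 2
    rw [hℓ, Nat.mul_div_cancel_left _ hg0]
  obtain ⟨A, h, hR, hS⟩ := exists_isTraceQuadric_powForm (F := F) (K := K) (ε := ε) hp
    (by rw [hm, hℓ]; ring) hg0 hs0 hfodd (Nat.Coprime.coprime_mul_left hcop) hε'
  rw [← hf] at h hS
  rw [← hℓ] at hS
  have hone : powForm F K e 1 = ((2 * ℓ : ℕ) : F) := by rw [powForm_one, hm]
  have hlt : ε + 2 ≤ ℓ ∧ (((2 * ℓ : ℕ) : F) = 0 → ε + 3 ≤ ℓ) := by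
    have h3 : ((2 * ℓ : ℕ) : F) = 0 → ε + 3 ≤ ℓ := by
      intro h0
      have hpr : p.Prime := Fact.out
      refine add_three_le_of_dvd hpr hp hℓ (by omega) hε' ?_
      exact (hpr.dvd_mul.mp ((CharP.cast_eq_zero_iff F p _).mp h0)).resolve_left
        fun h => hp ((Nat.prime_dvd_prime_iff_eq hpr Nat.prime_two).mp h)
    refine ⟨?_, h3⟩
    by_cases h0 : ((2 * ℓ : ℕ) : F) = 0
    · have := h3 h0
      omega
    · have := hmε h0
      omega
  -- Since ℓ = ε + 2 + j, none of the natural-number subtractions in the exponents truncates. When m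
  -- = 0 in F, moreover j ≥ 1, which supplies q ≤ q^j.
  obtain ⟨j, hj⟩ := Nat.exists_eq_add_of_le hlt.1
  have hq3 : (3 : ℚ) ≤ Fintype.card F := by
    have h1 : 1 < Fintype.card F := Fintype.one_lt_card
    have h3 : Fintype.card F ≠ 2 := by
      intro hc
      have := Nat.cast_card_eq_zero (R := F)
      rw [hc] at this
      exact h.two_ne (by exact_mod_cast this)
    have : 3 ≤ Fintype.card F := by omega
    exact_mod_cast this
  have hK : (Fintype.card K : ℚ) = (Fintype.card F : ℚ) ^ (2 * ℓ) := by
    rw [Module.card_eq_pow_finrank (K := F), hm]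
    push_cast
    rfl
  have hR' : ((Finset.univ.filter fun y => A y = 0).card : ℚ) = ((Fintype.card F : ℚ) ^ ε) ^ 2 := by
    rw [hR, ← pow_mul, mul_comm]
    push_cast
    rfl
  have hS' : (zeroExcess (powForm F K e) : ℚ) = -(Fintype.card F : ℚ) ^ (ℓ + ε) := by
    rw [hS]
    push_cast
    rfl
  have hjx : ((2 * ℓ : ℕ) : F) = 0 → (Fintype.card F : ℚ) ≤ (Fintype.card F : ℚ) ^ j := by
    intro h0
    have := hlt.2 h0
    exact le_self_pow₀ (by linarith) (by omega)
  set q : ℚ := (Fintype.card F : ℚ) with hqdef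
  have hq1 : 1 ≤ q := by linarith
  have hx : 1 ≤ q ^ j := one_le_pow₀ hq1
  have hy : 1 ≤ q ^ ε := one_le_pow₀ hq1
  rw [(by omega : 2 * ℓ = 2 * ε + 2 * j + 4)] at hK
  rw [(by omega : ℓ + ε = 2 * ε + j + 2)] at hS'
  have hK' : (Fintype.card K : ℚ) = (q ^ ε) ^ 2 * (q ^ j) ^ 2 * q ^ 4 := by
    rw [hK]
    ring
  have hS'' : (zeroExcess (powForm F K e) : ℚ) = -((q ^ ε) ^ 2 * q ^ j * q ^ 2) := by
    rw [hS']
    ring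
  have e₁ : q ^ (2 * ℓ - 1) = (q ^ ε) ^ 2 * (q ^ j) ^ 2 * q ^ 3 := by
    rw [(by omega : 2 * ℓ - 1 = 2 * ε + 2 * j + 3)]
    ring
  have e₂ : q ^ (2 * ℓ - 2) = (q ^ ε) ^ 2 * (q ^ j) ^ 2 * q ^ 2 := by
    rw [(by omega : 2 * ℓ - 2 = 2 * ε + 2 * j + 2)]
    ring
  have e₃ : q ^ (2 * ℓ - 3) = (q ^ ε) ^ 2 * (q ^ j) ^ 2 * q := by
    rw [(by omega : 2 * ℓ - 3 = 2 * ε + 2 * j + 1)]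
    ring
  have e₄ : q ^ (ℓ + ε - 1) = (q ^ ε) ^ 2 * q ^ j * q := by
    rw [(by omega : ℓ + ε - 1 = 2 * ε + j + 1)]
    ring
  have e₅ : q ^ (ℓ + ε - 2) = (q ^ ε) ^ 2 * q ^ j := by
    rw [(by omega : ℓ + ε - 2 = 2 * ε + j)]
    ring
  have e₆ : q ^ (2 * ℓ - 2 * ε - 1) = (q ^ j) ^ 2 * q ^ 3 := by
    rw [(by omega : 2 * ℓ - 2 * ε - 1 = 2 * j + 3)]
    ring
  have e₇ : q ^ (2 * ℓ - 2 * ε - 2) = (q ^ j) ^ 2 * q ^ 2 := by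
    rw [(by omega : 2 * ℓ - 2 * ε - 2 = 2 * j + 2)]
    ring
  have e₈ : q ^ (2 * ℓ - 2 * ε - 3) = (q ^ j) ^ 2 * q := by
    rw [(by omega : 2 * ℓ - 2 * ε - 3 = 2 * j + 1)]
    ring
  have e₉ : q ^ (ℓ - ε) = q ^ j * q ^ 2 := by
    rw [(by omega : ℓ - ε = j + 2)]
    ring
  have e₁₀ : q ^ (ℓ - ε - 1) = q ^ j * q := by
    rw [(by omega : ℓ - ε - 1 = j + 1)]
    ring
  have e₁₁ : q ^ (ℓ - ε - 2) = q ^ j := by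
    rw [(by omega : ℓ - ε - 2 = j)]
  rw [e₁, e₂, e₃, e₄, e₅, e₆, e₇, e₈, e₉, e₁₀, e₁₁]
  rw [← hone] at hjx ⊢
  rw [← hm]
  by_cases h1 : powForm F K e 1 = 0
  · by_cases hu : u = 0
    · subst hu
      obtain ⟨c₁, c₂, c₃, c₄, c₅⟩ :=
        h.code_of_zero_of_isotropic h1 hqdef.symm hq3 (hjx h1) hy hK' hR' hS''
      exact ⟨c₂, c₃, fun _ h => absurd h1 h, fun _ _ => ⟨c₁, c₅, c₄⟩, fun h => absurd rfl h,
        fun h => absurd rfl h⟩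
    · obtain ⟨c₁, c₂, c₃, c₄, c₅⟩ :=
        h.code_of_ne_zero_of_isotropic h1 hu hqdef.symm hq3 (hjx h1) hy hK' hR' hS''
      exact ⟨c₂, c₃, fun h => absurd h hu, fun h => absurd h hu, fun _ h => absurd h1 h,
        fun _ _ => ⟨c₁, c₅, c₄⟩⟩
  · by_cases hu : u = 0
    · subst hu
      obtain ⟨c₁, c₂, c₃, c₄, c₅⟩ :=
        h.code_of_zero_of_anisotropic h1 hqdef.symm hq3 hx hy hK' hR' hS''
      exact ⟨c₂, c₃, fun _ _ => ⟨c₁, c₅, c₄⟩, fun _ h => absurd h h1, fun h => absurd rfl h,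
        fun h => absurd rfl h⟩
    -- The number of weights and the dimension do not mention η, so they are read off at its actual
    -- value before an arbitrary η with the defining equation is introduced.
    · obtain ⟨-, c₂, c₃, -⟩ :=
        h.code_of_ne_zero_of_anisotropic h1 hu hqdef.symm hq3 hx hy hK' hR' hS'' rfl
      refine ⟨c₂, c₃, fun h => absurd h hu, fun h => absurd h hu, fun _ _ η hη => ?_,
        fun _ h => absurd h h1⟩
      obtain ⟨c₁, -, -, c₄⟩ :=
        h.code_of_ne_zero_of_anisotropic h1 hu hqdef.symm hq3 hx hy hK' hR' hS'' hη
      exact ⟨c₁, c₄⟩
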